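/- **Language.** Fix a set of primitive binary operators $\oplus$, each denoting a total function $\mathbb Z\times\mathbb Z\to\mathbb Z$ (the set may be empty). Types are $\tau ::= \mathbf{int}\mid\mathbf{unit}\mid\alpha\mid\tau\times\tau\mid\tau\to\tau\mid\forall\alpha.\tau$. Terms, taken up to renaming of bound variables, are variables, integers $n$, $\langle\rangle$, $e\oplus e$, pairs, projections $\pi_i e$, $\lambda x{:}\tau.e$, applications, $\Lambda\alpha.e$ and $e[\tau]$. The values are $n$, $\langle\rangle$, pairs of values, $\lambda x{:}\tau.e$ and $\Lambda\alpha.e$. Typing $\Delta,\Gamma\vdash e:\tau$ is that of System F with these constructs, all types being well formed under $\Delta$; reduction $\to^*$ is call-by-value, left to right. **Logical relation.** $\mathrm{Rel}(\tau_1,\tau_2)$ is the set of relations between closed values of the closed types $\tau_1$ and $\tau_2$. An environment $\rho$ maps type variables $\alpha$ to triples $\langle\tau_1,\tau_2,R\rangle$ with $R\in\mathrm{Rel}(\tau_1,\tau_2)$, and term variables to pairs of closed values; $\rho_L$, $\rho_R$ denote substitution by first, respectively second, components. The relation $\mathcal V[\![\tau]\!]_\rho$ on closed values consists of well-typed pairs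 ($\vdash v_1:\rho_L(\tau)$, $\vdash v_2:\rho_R(\tau)$) and is defined by induction on $\tau$: at $\mathbf{int}$ and $\mathbf{unit}$ it is the identity; at $\alpha$ it is the relation $R$ in $\rho(\alpha)$; at $\tau_1\times\tau_2$ it is componentwise; $\langle v_1,v_2\rangle$ is related at $\tau_1\to\tau_2$ iff $\langle v_1v_1',v_2v_2'\rangle\in\mathcal E[\![\tau_2]\!]_\rho$ for all $\langle v_1',v_2'\rangle\in\mathcal V[\![\tau_1]\!]_\rho$; and at $\forall\alpha.\tau$ iff $\langle v_1[\tau_1],v_2[\tau_2]\rangle\in\mathcal E[\![\tau]\!]_{\rho,\alpha\mapsto\langle\tau_1,\tau_2,R\rangle}$ for all closed $\tau_1,\tau_2$ and $R\in\mathrm{Rel}(\tau_1,\tau_2)$. Moreover $\langle e_1,e_2\rangle\in\mathcal E[\![\tau]\!]_\rho$ iff $\vdash e_1:\rho_L(\tau)$, $\vdash e_2:\rho_R(\tau)$, and $e_1\to^*v_1$, $e_2\to^*v_2$ for some $\langle v_1,v_2\rangle\in\mathcal V[\![\tau]\!]_\rho$. **Policy.** A policy $\mathcal P$ consists of a finite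 lattice $(\mathcal L,\sqsubseteq)$, a finite set $\mathbf I$ of inputs, levels $\mathrm{lvl}:\mathbf I\to\mathcal L$, and a partial function $\mathbf F$ from $\mathbf I$ to pairs $(f,l')$, where $l'\in\mathcal L$ and $f$ is (a name of) a closed term of type $\mathbf{int}\to\tau_f$ with $\tau_f$ a closed type, such that $\mathbf F(x)=(f,l')$ implies $\mathrm{lvl}(x)\not\sqsubseteq l'$. (One function may occur under several names; the type variables below are indexed by names.) **Contexts.** $\Delta_{\mathcal P}$ consists of the type variables $\alpha_l$ for $l\in\mathcal L$, and $\alpha_{l}^f$ and $\alpha^f$ for every $x$ with $\mathbf F(x)=(f,l')$ and $\mathrm{lvl}(x)=l$. $\Gamma_{\mathcal P}$ consists of * $x:\alpha_l\to\mathbf{int}$ for $x\in\mathbf I\setminus\mathrm{dom}\,\mathbf F$ with $\mathrm{lvl}(x)=l$; * $x:\alpha_l^f\to\alpha^f$, $\;x_f:(\alpha_l^f\to\alpha^f)\to\alpha_{l'}\to\tau_f$ and $\mathrm{conv}_x:(\alpha_l^f\to\alpha^f)\to\alpha_l\to\mathbf{int}$ for $x\in\mathbf I$ with $\mathbf F(x)=(f,l')$,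 $\mathrm{lvl}(x)=l$; * $\mathrm{comp}_l:\forall\beta_1,\beta_2.(\alpha_l\to\beta_1)\to(\beta_1\to(\alpha_l\to\beta_2))\to\alpha_l\to\beta_2$ and $\mathrm{wrap}_l:\forall\beta.\beta\to\alpha_l\to\beta$ for $l\in\mathcal L$; * $\mathrm{convup}_{l,l'}:\forall\beta.(\alpha_l\to\beta)\to(\alpha_{l'}\to\beta)$ for $l\sqsubset l'$ in $\mathcal L$. **Environments for $\mathcal P$.** Let $\zeta\in\mathcal L$ (an observer). An environment $\rho$ with type-variable domain $\Delta_{\mathcal P}$ is an *environment for $\mathcal P$ with respect to $\zeta$* if, for every $l\in\mathcal L$, $\rho(\alpha_l)=\langle\mathbf{unit},\mathbf{unit},\mathrm{Full}_{\mathbf{unit}}\rangle$ when $l\sqsubseteq\zeta$ and $\langle\mathbf{unit},\mathbf{unit},\emptyset\rangle$ otherwise, and for every $x$ with $\mathbf F(x)=(f,l')$ and $\mathrm{lvl}(x)=l$: $\rho(\alpha_l^f)=\langle\mathbf{unit},\mathbf{unit},\mathrm{Full}_{\mathbf{unit}}\rangle$ when $l\sqsubseteq\zeta$ or $l'\sqsubseteq\zeta$,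 and $\langle\mathbf{unit},\mathbf{unit},\emptyset\rangle$ otherwise; and $\rho(\alpha^f)=\langle\mathbf{int},\mathbf{int},R\rangle$ with $R$ the identity when $l\sqsubseteq\zeta$, $R=R_f=\{\langle v_1,v_2\rangle\mid\langle f\,v_1,f\,v_2\rangle\in\mathcal E[\![\tau_f]\!]_\emptyset\}$ when $l'\sqsubseteq\zeta$ and $l\not\sqsubseteq\zeta$, and $R=\mathrm{Full}_{\mathbf{int}}$ (all pairs of integers) otherwise. Such a $\rho$ is unique on $\Delta_{\mathcal P}$ if it exists, and indistinguishability for $\zeta$ at a type $\tau$ over $\Delta_{\mathcal P}$ is defined by it: $I^\zeta_{\mathcal P}[\![\tau]\!]=\mathcal V[\![\tau]\!]_\rho$ on values and $I^\zeta_{\mathcal P}[\![\tau]\!]^{\mathrm{ev}}=\mathcal E[\![\tau]\!]_\rho$ on terms. $\rho$ is a *full environment for $\mathcal P$ with respect to $\zeta$* if moreover it is defined on all variables of $\Gamma_{\mathcal P}$, maps each input $x$ with $x:\tau$ in $\Gamma_{\mathcal P}$ to a pair in $I^\zeta_{\mathcal P}[\![\tau]\!]$, and maps each interface variable to the pair of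 twice its implementation: $$\begin{aligned}\mathrm{comp}_l&:\ \Lambda\beta_1,\beta_2.\lambda x{:}\mathbf{unit}\to\beta_1.\lambda g{:}\beta_1\to(\mathbf{unit}\to\beta_2).\,g\,(x\,\langle\rangle),\\ \mathrm{convup}_{l,l'}&:\ \Lambda\beta.\lambda x{:}\mathbf{unit}\to\beta.\,x,\qquad \mathrm{wrap}_l:\ \Lambda\beta.\lambda x{:}\beta.\lambda\_{:}\mathbf{unit}.\,x,\\ x_f&:\ \lambda y{:}\mathbf{unit}\to\mathbf{int}.\lambda\_{:}\mathbf{unit}.\,f\,(y\,\langle\rangle),\qquad \mathrm{conv}_x:\ \lambda y{:}\mathbf{unit}\to\mathbf{int}.\,y.\end{aligned}$$ **Theorem.** Let $\mathcal P$ be a policy and suppose $\Delta_{\mathcal P},\Gamma_{\mathcal P}\vdash e:\tau$. Then for every observer $\zeta\in\mathcal L$ and every full environment $\rho$ for $\mathcal P$ with respect to $\zeta$, $$\langle\rho_L(e),\rho_R(e)\rangle\in I^\zeta_{\mathcal P}[\![\tau]\!]^{\mathrm{ev}}.$$ -/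

import Mathlib

universe u v w z

namespace MultiLevel

/-- The primitive (total, binary) arithmetic operators of the language. -/
structure PrimOps where
  Sym : Type
  eval : Sym → ℤ → ℤ → ℤ

/-! ## Syntax

Free variables are names (`A` is the set of type variables of the typing context, `X` the set of
term variables of the term context); variables bound by `λ`, `Λ`, `∀` are de Bruijn indices,
so terms are identified up to renaming of bound variables. -/

/-- Types with free type variables in `A` and `n` further bound type variables in scope. -/
inductive Ty (A : Type u) : ℕ → Type u where
  | fvar {n : ℕ} (a : A) : Ty A n
  | bvar {n : ℕ} (i : Fin n) : Ty A n
  | int {n : ℕ} : Ty A n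
  | unit {n : ℕ} : Ty A n
  | prod {n : ℕ} (s t : Ty A n) : Ty A n
  | arr {n : ℕ} (s t : Ty A n) : Ty A n
  | all {n : ℕ} (t : Ty A (n + 1)) : Ty A n

/-- Terms with free type variables in `A`, free term variables in `X`, and `n` bound type
variables and `m` bound term variables in scope. -/
inductive Tm (O : PrimOps) (A : Type u) (X : Type v) : ℕ → ℕ → Type (max u v) where
  | fvar {n m : ℕ} (x : X) : Tm O A X n m
  | bvar {n m : ℕ} (i : Fin m) : Tm O A X n m
  | lit {n m : ℕ} (k : ℤ) : Tm O A X n m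
  | star {n m : ℕ} : Tm O A X n m
  | op {n m : ℕ} (o : O.Sym) (e₁ e₂ : Tm O A X n m) : Tm O A X n m
  | pair {n m : ℕ} (e₁ e₂ : Tm O A X n m) : Tm O A X n m
  | fst {n m : ℕ} (e : Tm O A X n m) : Tm O A X n m
  | snd {n m : ℕ} (e : Tm O A X n m) : Tm O A X n m
  | lam {n m : ℕ} (t : Ty A n) (e : Tm O A X n (m + 1)) : Tm O A X n m
  | app {n m : ℕ} (e₁ e₂ : Tm O A X n m) : Tm O A X n m
  | tlam {n m : ℕ} (e : Tm O A X (n + 1) m) : Tm O A X n m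
  | tapp {n m : ℕ} (e : Tm O A X n m) (t : Ty A n) : Tm O A X n m

/-- Closed types. -/
abbrev CTy : Type := Ty Empty 0

/-- Closed terms. -/
abbrev CTm (O : PrimOps) : Type := Tm O Empty Empty 0 0

/-! ## Substitution -/

/-- The empty assignment (for an empty list of bound variables). -/
def nil {T : Type u} : Fin 0 → T := fun i => i.elim0

/-- Extend an assignment for `n` bound variables by a value for a new innermost one. -/
def snoc {T : Type u} {n : ℕ} (a : T) (σ : Fin n → T) : Fin (n + 1) → T :=
  fun i => Fin.cases (motive := fun _ => T) a σ i

/-- Extend a renaming of bound variables under one more binder. -/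
def liftRen {n m : ℕ} (ξ : Fin n → Fin m) : Fin (n + 1) → Fin (m + 1) :=
  snoc 0 (fun i => (ξ i).succ)

def Ty.ren {A : Type u} : {n m : ℕ} → (Fin n → Fin m) → Ty A n → Ty A m
  | _, _, _, .fvar a => .fvar a
  | _, _, ξ, .bvar i => .bvar (ξ i)
  | _, _, _, .int => .int
  | _, _, _, .unit => .unit
  | _, _, ξ, .prod s t => .prod (s.ren ξ) (t.ren ξ)
  | _, _, ξ, .arr s t => .arr (s.ren ξ) (t.ren ξ)
  | _, _, ξ, .all t => .all (t.ren (liftRen ξ))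

/-- Weakening by one bound type variable. -/
def Ty.weaken {A : Type u} {n : ℕ} (t : Ty A n) : Ty A (n + 1) := t.ren Fin.succ

/-- Simultaneous capture-avoiding substitution: `δ` for the free variables, `σ` for the bound
variables in scope. -/
def Ty.subst {A : Type u} {B : Type v} :
    {n m : ℕ} → (A → Ty B m) → (Fin n → Ty B m) → Ty A n → Ty B m
  | _, _, δ, _, .fvar a => δ a
  | _, _, _, σ, .bvar i => σ i
  | _, _, _, _, .int => .int
  | _, _, _, _, .unit => .unit
  | _, _, δ, σ, .prod s t => .prod (s.subst δ σ) (t.subst δ σ)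
  | _, _, δ, σ, .arr s t => .arr (s.subst δ σ) (t.subst δ σ)
  | _, _, δ, σ, .all t =>
      .all (t.subst (fun a => (δ a).weaken) (snoc (.bvar 0) (fun i => (σ i).weaken)))

/-- `t[s/α]` for the innermost bound variable `α` of `t`. -/
def Ty.inst {A : Type u} {n : ℕ} (t : Ty A (n + 1)) (s : Ty A n) : Ty A n :=
  t.subst Ty.fvar (snoc s Ty.bvar)

/-- A closed type seen as a type over an arbitrary typing context. -/
def Ty.embed {A : Type u} {n : ℕ} (t : CTy) : Ty A n := t.subst (fun a => a.elim) nil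

def Tm.ren {O : PrimOps} {A : Type u} {X : Type v} : {n n' m m' : ℕ} →
    (Fin n → Fin n') → (Fin m → Fin m') → Tm O A X n m → Tm O A X n' m'
  | _, _, _, _, _, _, .fvar x => .fvar x
  | _, _, _, _, _, χ, .bvar i => .bvar (χ i)
  | _, _, _, _, _, _, .lit k => .lit k
  | _, _, _, _, _, _, .star => .star
  | _, _, _, _, ξ, χ, .op o e₁ e₂ => .op o (e₁.ren ξ χ) (e₂.ren ξ χ)
  | _, _, _, _, ξ, χ, .pair e₁ e₂ => .pair (e₁.ren ξ χ) (e₂.ren ξ χ)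
  | _, _, _, _, ξ, χ, .fst e => .fst (e.ren ξ χ)
  | _, _, _, _, ξ, χ, .snd e => .snd (e.ren ξ χ)
  | _, _, _, _, ξ, χ, .lam t e => .lam (t.ren ξ) (e.ren ξ (liftRen χ))
  | _, _, _, _, ξ, χ, .app e₁ e₂ => .app (e₁.ren ξ χ) (e₂.ren ξ χ)
  | _, _, _, _, ξ, χ, .tlam e => .tlam (e.ren (liftRen ξ) χ)
  | _, _, _, _, ξ, χ, .tapp e t => .tapp (e.ren ξ χ) (t.ren ξ)

/-- Simultaneous capture-avoiding substitution: `δ`, `σ` for the free and bound type variables,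
`γ`, `θ` for the free and bound term variables. -/
def Tm.subst {O : PrimOps} {A : Type u} {X : Type v} {B : Type w} {Y : Type z} :
    {n n' m m' : ℕ} → (A → Ty B n') → (Fin n → Ty B n') →
    (X → Tm O B Y n' m') → (Fin m → Tm O B Y n' m') → Tm O A X n m → Tm O B Y n' m'
  | _, _, _, _, _, _, γ, _, .fvar x => γ x
  | _, _, _, _, _, _, _, θ, .bvar i => θ i
  | _, _, _, _, _, _, _, _, .lit k => .lit k
  | _, _, _, _, _, _, _, _, .star => .star
  | _, _, _, _, δ, σ, γ, θ, .op o e₁ e₂ => .op o (e₁.subst δ σ γ θ) (e₂.subst δ σ γ θ)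
  | _, _, _, _, δ, σ, γ, θ, .pair e₁ e₂ => .pair (e₁.subst δ σ γ θ) (e₂.subst δ σ γ θ)
  | _, _, _, _, δ, σ, γ, θ, .fst e => .fst (e.subst δ σ γ θ)
  | _, _, _, _, δ, σ, γ, θ, .snd e => .snd (e.subst δ σ γ θ)
  | _, _, _, _, δ, σ, γ, θ, .lam t e =>
      .lam (t.subst δ σ) (e.subst δ σ (fun x => (γ x).ren id Fin.succ)
        (snoc (.bvar 0) (fun i => (θ i).ren id Fin.succ)))
  | _, _, _, _, δ, σ, γ, θ, .app e₁ e₂ => .app (e₁.subst δ σ γ θ) (e₂.subst δ σ γ θ)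
  | _, _, _, _, δ, σ, γ, θ, .tlam e =>
      .tlam (e.subst (fun a => (δ a).weaken) (snoc (.bvar 0) (fun i => (σ i).weaken))
        (fun x => (γ x).ren Fin.succ id) (fun i => (θ i).ren Fin.succ id))
  | _, _, _, _, δ, σ, γ, θ, .tapp e t => .tapp (e.subst δ σ γ θ) (t.subst δ σ)

/-- `e[x ↦ e']` for the innermost bound term variable `x` of `e`. -/
def Tm.inst {O : PrimOps} {A : Type u} {X : Type v} {n m : ℕ}
    (e : Tm O A X n (m + 1)) (e' : Tm O A X n m) : Tm O A X n m :=
  e.subst Ty.fvar Ty.bvar Tm.fvar (snoc e' Tm.bvar)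

/-- `e[t/α]` for the innermost bound type variable `α` of `e`. -/
def Tm.tinst {O : PrimOps} {A : Type u} {X : Type v} {n m : ℕ}
    (e : Tm O A X (n + 1) m) (t : Ty A n) : Tm O A X n m :=
  e.subst Ty.fvar (snoc t Ty.bvar) Tm.fvar Tm.bvar

/-- A closed term seen as a term over arbitrary contexts. -/
def Tm.embed {O : PrimOps} {A : Type u} {X : Type v} {n m : ℕ} (e : CTm O) : Tm O A X n m :=
  e.subst (fun a => a.elim) nil (fun x => x.elim) nil

/-! ## Typing

`HasType Γ Φ e t`: `Γ` types the free term variables, `Φ` the bound term variables in scope.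
Well-formedness of all types under the typing context is built into the syntax. -/

inductive HasType {O : PrimOps} {A : Type u} {X : Type v} : {n m : ℕ} →
    (X → Ty A n) → (Fin m → Ty A n) → Tm O A X n m → Ty A n → Prop where
  | fvar {n m : ℕ} {Γ : X → Ty A n} {Φ : Fin m → Ty A n} (x : X) : HasType Γ Φ (.fvar x) (Γ x)
  | bvar {n m : ℕ} {Γ : X → Ty A n} {Φ : Fin m → Ty A n} (i : Fin m) :
      HasType Γ Φ (.bvar i) (Φ i)
  | lit {n m : ℕ} {Γ : X → Ty A n} {Φ : Fin m → Ty A n} (k : ℤ) : HasType Γ Φ (.lit k) .int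
  | star {n m : ℕ} {Γ : X → Ty A n} {Φ : Fin m → Ty A n} : HasType Γ Φ .star .unit
  | op {n m : ℕ} {Γ : X → Ty A n} {Φ : Fin m → Ty A n} {e₁ e₂ : Tm O A X n m} (o : O.Sym) :
      HasType Γ Φ e₁ .int → HasType Γ Φ e₂ .int → HasType Γ Φ (.op o e₁ e₂) .int
  | pair {n m : ℕ} {Γ : X → Ty A n} {Φ : Fin m → Ty A n} {e₁ e₂ : Tm O A X n m}
      {t₁ t₂ : Ty A n} :
      HasType Γ Φ e₁ t₁ → HasType Γ Φ e₂ t₂ → HasType Γ Φ (.pair e₁ e₂) (.prod t₁ t₂)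
  | fst {n m : ℕ} {Γ : X → Ty A n} {Φ : Fin m → Ty A n} {e : Tm O A X n m} {t₁ t₂ : Ty A n} :
      HasType Γ Φ e (.prod t₁ t₂) → HasType Γ Φ (.fst e) t₁
  | snd {n m : ℕ} {Γ : X → Ty A n} {Φ : Fin m → Ty A n} {e : Tm O A X n m} {t₁ t₂ : Ty A n} :
      HasType Γ Φ e (.prod t₁ t₂) → HasType Γ Φ (.snd e) t₂
  | lam {n m : ℕ} {Γ : X → Ty A n} {Φ : Fin m → Ty A n} {e : Tm O A X n (m + 1)}
      {t₁ t₂ : Ty A n} :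
      HasType Γ (snoc t₁ Φ) e t₂ → HasType Γ Φ (.lam t₁ e) (.arr t₁ t₂)
  | app {n m : ℕ} {Γ : X → Ty A n} {Φ : Fin m → Ty A n} {e₁ e₂ : Tm O A X n m}
      {t₁ t₂ : Ty A n} :
      HasType Γ Φ e₁ (.arr t₁ t₂) → HasType Γ Φ e₂ t₁ → HasType Γ Φ (.app e₁ e₂) t₂
  | tlam {n m : ℕ} {Γ : X → Ty A n} {Φ : Fin m → Ty A n} {e : Tm O A X (n + 1) m}
      {t : Ty A (n + 1)} :
      HasType (fun x => (Γ x).weaken) (fun i => (Φ i).weaken) e t →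
      HasType Γ Φ (.tlam e) (.all t)
  | tapp {n m : ℕ} {Γ : X → Ty A n} {Φ : Fin m → Ty A n} {e : Tm O A X n m}
      {t : Ty A (n + 1)} (s : Ty A n) :
      HasType Γ Φ e (.all t) → HasType Γ Φ (.tapp e s) (t.inst s)

/-- `⊢ e : t` for closed `e` and `t`. -/
def CHasType {O : PrimOps} (e : CTm O) (t : CTy) : Prop :=
  HasType (fun x : Empty => x.elim) nil e t

/-! ## Call-by-value semantics -/

inductive IsValue {O : PrimOps} {A : Type u} {X : Type v} {n m : ℕ} : Tm O A X n m → Prop where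
  | lit (k : ℤ) : IsValue (.lit k)
  | star : IsValue .star
  | pair {v₁ v₂ : Tm O A X n m} : IsValue v₁ → IsValue v₂ → IsValue (.pair v₁ v₂)
  | lam (t : Ty A n) (e : Tm O A X n (m + 1)) : IsValue (.lam t e)
  | tlam (e : Tm O A X (n + 1) m) : IsValue (.tlam e)

/-- Small-step reduction: the basic reductions, closed under evaluation contexts. -/
inductive Step {O : PrimOps} {A : Type u} {X : Type v} {n m : ℕ} :
    Tm O A X n m → Tm O A X n m → Prop where
  | fst_pair {v₁ v₂ : Tm O A X n m} : IsValue v₁ → IsValue v₂ → Step (.fst (.pair v₁ v₂)) v₁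
  | snd_pair {v₁ v₂ : Tm O A X n m} : IsValue v₁ → IsValue v₂ → Step (.snd (.pair v₁ v₂)) v₂
  | beta {t : Ty A n} {e : Tm O A X n (m + 1)} {a : Tm O A X n m} :
      IsValue a → Step (.app (.lam t e) a) (e.inst a)
  | tbeta {e : Tm O A X (n + 1) m} {t : Ty A n} : Step (.tapp (.tlam e) t) (e.tinst t)
  | op_lit {o : O.Sym} {j k : ℤ} : Step (.op o (.lit j) (.lit k)) (.lit (O.eval o j k))
  | op_left {o : O.Sym} {e₁ e₁' e₂ : Tm O A X n m} :
      Step e₁ e₁' → Step (.op o e₁ e₂) (.op o e₁' e₂)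
  | op_right {o : O.Sym} {e₁ e₂ e₂' : Tm O A X n m} :
      IsValue e₁ → Step e₂ e₂' → Step (.op o e₁ e₂) (.op o e₁ e₂')
  | pair_left {e₁ e₁' e₂ : Tm O A X n m} : Step e₁ e₁' → Step (.pair e₁ e₂) (.pair e₁' e₂)
  | pair_right {e₁ e₂ e₂' : Tm O A X n m} :
      IsValue e₁ → Step e₂ e₂' → Step (.pair e₁ e₂) (.pair e₁ e₂')
  | fst {e e' : Tm O A X n m} : Step e e' → Step (.fst e) (.fst e')
  | snd {e e' : Tm O A X n m} : Step e e' → Step (.snd e) (.snd e')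
  | app_left {e₁ e₁' e₂ : Tm O A X n m} : Step e₁ e₁' → Step (.app e₁ e₂) (.app e₁' e₂)
  | app_right {e₁ e₂ e₂' : Tm O A X n m} :
      IsValue e₁ → Step e₂ e₂' → Step (.app e₁ e₂) (.app e₁ e₂')
  | tapp {e e' : Tm O A X n m} {t : Ty A n} : Step e e' → Step (.tapp e t) (.tapp e' t)

/-- `e →* e'`. -/
def Steps {O : PrimOps} (e e' : CTm O) : Prop := Relation.ReflTransGen Step e e'

/-- `v` is a closed value of the closed type `t`. -/
def IsValueOf {O : PrimOps} (t : CTy) (v : CTm O) : Prop := IsValue v ∧ CHasType v t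

/-! ## Logical relation -/

/-- A triple `⟨τ₁, τ₂, R⟩` with `R ∈ Rel(τ₁, τ₂)`, a relation between the closed values of the
closed type `τ₁` and those of the closed type `τ₂`. -/
structure Interp (O : PrimOps) where
  left : CTy
  right : CTy
  rel : CTm O → CTm O → Prop
  wf : ∀ v w : CTm O, rel v w → IsValueOf left v ∧ IsValueOf right w

/-- Rule for terms: from a relation `R` on values of the types `t₁`, `t₂` to one on terms. -/
def TermRel {O : PrimOps} (t₁ t₂ : CTy) (R : CTm O → CTm O → Prop) (e₁ e₂ : CTm O) : Prop :=
  CHasType e₁ t₁ ∧ CHasType e₂ t₂ ∧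
    ∃ v₁ v₂ : CTm O, IsValue v₁ ∧ IsValue v₂ ∧ Steps e₁ v₁ ∧ Steps e₂ v₂ ∧ R v₁ v₂

/-- `ρ_L(t)`, where `ρ` interprets the free and `η` the bound type variables. -/
def Ty.left {O : PrimOps} {A : Type u} {n : ℕ} (ρ : A → Interp O) (η : Fin n → Interp O)
    (t : Ty A n) : CTy :=
  t.subst (fun a => (ρ a).left) (fun i => (η i).left)

/-- `ρ_R(t)`. -/
def Ty.right {O : PrimOps} {A : Type u} {n : ℕ} (ρ : A → Interp O) (η : Fin n → Interp O)
    (t : Ty A n) : CTy :=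
  t.subst (fun a => (ρ a).right) (fun i => (η i).right)

/-- The logical relation on closed values at type `t`; the values related at an arrow or a
universal type are required to be well typed. -/
def ValRel {O : PrimOps} {A : Type u} (ρ : A → Interp O) :
    {n : ℕ} → Ty A n → (Fin n → Interp O) → CTm O → CTm O → Prop
  | _, .fvar a, _, v, w => (ρ a).rel v w
  | _, .bvar i, η, v, w => (η i).rel v w
  | _, .int, _, v, w => ∃ k : ℤ, v = .lit k ∧ w = .lit k
  | _, .unit, _, v, w => v = .star ∧ w = .star
  | _, .prod s t, η, v, w => ∃ v₁ v₂ w₁ w₂ : CTm O, v = .pair v₁ v₂ ∧ w = .pair w₁ w₂ ∧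
      ValRel ρ s η v₁ w₁ ∧ ValRel ρ t η v₂ w₂
  | _, .arr s t, η, v, w =>
      IsValueOf ((Ty.arr s t).left ρ η) v ∧ IsValueOf ((Ty.arr s t).right ρ η) w ∧
      ∀ v' w' : CTm O, ValRel ρ s η v' w' →
        TermRel (t.left ρ η) (t.right ρ η) (ValRel ρ t η) (.app v v') (.app w w')
  | _, .all t, η, v, w =>
      IsValueOf ((Ty.all t).left ρ η) v ∧ IsValueOf ((Ty.all t).right ρ η) w ∧
      ∀ J : Interp O,
        TermRel (t.left ρ (snoc J η)) (t.right ρ (snoc J η)) (ValRel ρ t (snoc J η))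
          (.tapp v J.left) (.tapp w J.right)

/-- The logical relation on closed terms at a type `t` over the typing context `A`. -/
def ExpRel {O : PrimOps} {A : Type u} (ρ : A → Interp O) (t : Ty A 0) : CTm O → CTm O → Prop :=
  TermRel (t.left ρ nil) (t.right ρ nil) (ValRel ρ t nil)

/-- The empty environment. -/
def emptyEnv {O : PrimOps} : Empty → Interp O := fun a => a.elim

/-- `⟨t, t, Full_t⟩`: any two closed values of type `t` are related. -/
def Interp.full {O : PrimOps} (t : CTy) : Interp O where
  left := t
  right := t
  rel v w := IsValueOf t v ∧ IsValueOf t w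
  wf _ _ h := h

/-- `⟨t, t, ∅⟩`. -/
def Interp.none {O : PrimOps} (t : CTy) : Interp O where
  left := t
  right := t
  rel _ _ := False
  wf _ _ h := h.elim

/-- `⟨int, int, id_int⟩`. -/
def Interp.idInt {O : PrimOps} : Interp O where
  left := .int
  right := .int
  rel v w := ∃ k : ℤ, v = .lit k ∧ w = .lit k
  wf := by
    rintro _ _ ⟨k, rfl, rfl⟩
    exact ⟨⟨.lit k, .lit k⟩, ⟨.lit k, .lit k⟩⟩

/-! ## Declassification policies -/

/-- A closed declassification function `f : int → τ_f`. -/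
structure Dec (O : PrimOps) where
  fn : CTm O
  cod : CTy
  typed : CHasType fn (.arr .int cod)

/-- `⟨int, int, R_f⟩`: two integers are related if `f` behaves the same on them. -/
def Interp.via {O : PrimOps} (f : Dec O) : Interp O where
  left := .int
  right := .int
  rel v w := IsValueOf .int v ∧ IsValueOf .int w ∧ ExpRel emptyEnv f.cod (.app f.fn v) (.app f.fn w)
  wf _ _ h := ⟨h.1, h.2.1⟩

/-- A multi-level declassification policy over the lattice `L` with the inputs `I`.
Declassification functions are referred to by names `f : D`, `dec f` being the function itself.
Since the type variables of the encoding are indexed by `f`, names matter: `D := Dec O`,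
`dec := id` identifies a name with its function, while two inputs declassified by one function
under two names get separate type variables. -/
structure Policy (O : PrimOps) (L : Type u) [Lattice L] (I : Type v) (D : Type w) where
  dec : D → Dec O
  lvl : I → L
  F : I → Option (D × L)
  not_le : ∀ (x : I) (f : D) (l : L), F x = some (f, l) → ¬ lvl x ≤ l

section Encoding

variable {O : PrimOps} {L : Type u} [Lattice L] {I : Type v} {D : Type w}

/-- The typing context `Δ_P`: the type variables `α_l`, `α_l^f` and `α^f`. -/
inductive TVar (P : Policy O L I D) : Type (max u v w) where
  | lev (l : L) : TVar P
  | key (l : L) (f : D) (h : ∃ x l', P.F x = some (f, l') ∧ P.lvl x = l) : TVar P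
  | val (f : D) (h : ∃ x l', P.F x = some (f, l')) : TVar P

/-- The domain of the term context `Γ_P`. -/
inductive Var (P : Policy O L I D) : Type (max u v w) where
  /-- An input `x` that cannot be declassified. -/
  | plain (x : I) (h : P.F x = none) : Var P
  /-- An input `x` that can be declassified via `f` to level `l`. -/
  | secret (x : I) (f : D) (l : L) (h : P.F x = some (f, l)) : Var P
  /-- The declassifier `x_f`. -/
  | decl (x : I) (f : D) (l : L) (h : P.F x = some (f, l)) : Var P
  /-- The interface `conv_x`. -/
  | conv (x : I) (f : D) (l : L) (h : P.F x = some (f, l)) : Var P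
  | comp (l : L) : Var P
  | convup (l l' : L) (h : l < l') : Var P
  | wrap (l : L) : Var P

namespace Policy

variable (P : Policy O L I D)

/-- `α_l`. -/
def tlev (l : L) {n : ℕ} : Ty (TVar P) n := .fvar (.lev l)

/-- `α_l^f → α^f`, the type of an input `x` at level `l` that can be declassified via `f`. -/
def secretTy (x : I) (f : D) (l' : L) (h : P.F x = some (f, l')) : Ty (TVar P) 0 :=
  .arr (.fvar (.key (P.lvl x) f ⟨x, l', h, rfl⟩)) (.fvar (.val f ⟨x, l', h⟩))

/-- The term context `Γ_P`. -/
def ctx : Var P → Ty (TVar P) 0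
  | .plain x _ => .arr (P.tlev (P.lvl x)) .int
  | .secret x f l' h => P.secretTy x f l' h
  | .decl x f l' h => .arr (P.secretTy x f l' h) (.arr (P.tlev l') (P.dec f).cod.embed)
  | .conv x f l' h => .arr (P.secretTy x f l' h) (.arr (P.tlev (P.lvl x)) .int)
  -- `∀ β₁ β₂. (α_l → β₁) → (β₁ → (α_l → β₂)) → α_l → β₂`
  | .comp l => .all (.all (.arr (.arr (P.tlev l) (.bvar 1))
      (.arr (.arr (.bvar 1) (.arr (P.tlev l) (.bvar 0))) (.arr (P.tlev l) (.bvar 0)))))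
  -- `∀ β. (α_l → β) → (α_l' → β)`
  | .convup l l' _ => .all (.arr (.arr (P.tlev l) (.bvar 0)) (.arr (P.tlev l') (.bvar 0)))
  -- `∀ β. β → α_l → β`
  | .wrap l => .all (.arr (.bvar 0) (.arr (P.tlev l) (.bvar 0)))

end Policy

/-! ## Implementations of the interfaces -/

/-- `Λ β₁ β₂. λ x : unit → β₁. λ f : β₁ → (unit → β₂). f (x ⟨⟩)`. -/
def compImpl : CTm O :=
  .tlam (.tlam (.lam (.arr .unit (.bvar 1)) (.lam (.arr (.bvar 1) (.arr .unit (.bvar 0)))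
    (.app (.bvar 0) (.app (.bvar 1) .star)))))

/-- `Λ β. λ x : unit → β. x`. -/
def convupImpl : CTm O := .tlam (.lam (.arr .unit (.bvar 0)) (.bvar 0))

/-- `Λ β. λ x : β. λ _ : unit. x`. -/
def wrapImpl : CTm O := .tlam (.lam (.bvar 0) (.lam .unit (.bvar 1)))

/-- `λ x : unit → int. λ _ : unit. f (x ⟨⟩)`. -/
def decImpl (f : Dec O) : CTm O :=
  .lam (.arr .unit .int) (.lam .unit (.app f.fn.embed (.app (.bvar 1) .star)))

/-- `λ x : unit → int. x`. -/
def convImpl : CTm O := .lam (.arr .unit .int) (.bvar 0)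

/-! ## Environments and indistinguishability -/

/-- `ρ` is an environment for `P` w.r.t. the observer `ζ` (on type variables). -/
structure EnvFor (P : Policy O L I D) (ζ : L) (ρ : TVar P → Interp O) : Prop where
  lev_low : ∀ l, l ≤ ζ → ρ (.lev l) = .full .unit
  lev_high : ∀ l, ¬ l ≤ ζ → ρ (.lev l) = .none .unit
  key_low : ∀ x f l' (h : P.F x = some (f, l')), (P.lvl x ≤ ζ ∨ l' ≤ ζ) →
    ρ (.key (P.lvl x) f ⟨x, l', h, rfl⟩) = .full .unit
  key_high : ∀ x f l' (h : P.F x = some (f, l')), ¬ (P.lvl x ≤ ζ ∨ l' ≤ ζ) →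
    ρ (.key (P.lvl x) f ⟨x, l', h, rfl⟩) = .none .unit
  val_low : ∀ x f l' (h : P.F x = some (f, l')), P.lvl x ≤ ζ →
    ρ (.val f ⟨x, l', h⟩) = .idInt
  val_mid : ∀ x f l' (h : P.F x = some (f, l')), l' ≤ ζ → ¬ P.lvl x ≤ ζ →
    ρ (.val f ⟨x, l', h⟩) = .via (P.dec f)
  val_high : ∀ x f l' (h : P.F x = some (f, l')), ¬ l' ≤ ζ → ¬ P.lvl x ≤ ζ →
    ρ (.val f ⟨x, l', h⟩) = .full .int

/-- There is at most one environment for `P` w.r.t. an observer. -/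
theorem EnvFor.unique {P : Policy O L I D} {ζ : L} {ρ ρ' : TVar P → Interp O}
    (h : EnvFor P ζ ρ) (h' : EnvFor P ζ ρ') : ρ = ρ' := by
  funext a
  cases a with
  | lev l =>
    by_cases hl : l ≤ ζ
    · rw [h.lev_low l hl, h'.lev_low l hl]
    · rw [h.lev_high l hl, h'.lev_high l hl]
  | key l f hx =>
    obtain ⟨x, l', hF, rfl⟩ := hx
    by_cases hl : P.lvl x ≤ ζ ∨ l' ≤ ζ
    · rw [h.key_low x f l' hF hl, h'.key_low x f l' hF hl]
    · rw [h.key_high x f l' hF hl, h'.key_high x f l' hF hl]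
  | val f hx =>
    obtain ⟨x, l', hF⟩ := hx
    by_cases hl : P.lvl x ≤ ζ
    · rw [h.val_low x f l' hF hl, h'.val_low x f l' hF hl]
    · by_cases hl' : l' ≤ ζ
      · rw [h.val_mid x f l' hF hl' hl, h'.val_mid x f l' hF hl' hl]
      · rw [h.val_high x f l' hF hl' hl, h'.val_high x f l' hF hl' hl]

/-- Indistinguishability of values at `t` for the observer `ζ`: the logical relation in the
(unique) environment for `P` w.r.t. `ζ`. -/
def IndVal (P : Policy O L I D) (ζ : L) (t : Ty (TVar P) 0) (v w : CTm O) : Prop :=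
  ∃ ρ : TVar P → Interp O, EnvFor P ζ ρ ∧ ValRel ρ t nil v w

/-- Indistinguishability of terms at `t` for the observer `ζ`. -/
def IndTerm (P : Policy O L I D) (ζ : L) (t : Ty (TVar P) 0) (e₁ e₂ : CTm O) : Prop :=
  ∃ ρ : TVar P → Interp O, EnvFor P ζ ρ ∧ ExpRel ρ t e₁ e₂

/-- An environment: type variables are mapped to triples `⟨τ₁, τ₂, R⟩`, term variables to
pairs of closed terms (they are values by `FullEnv` below). -/
structure Env (P : Policy O L I D) where
  ty : TVar P → Interp O
  tm : Var P → CTm O × CTm O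

/-- `ρ_L(e)`. -/
def Env.applyL {P : Policy O L I D} (ρ : Env P) (e : Tm O (TVar P) (Var P) 0 0) : CTm O :=
  e.subst (fun a => (ρ.ty a).left) nil (fun x => (ρ.tm x).1) nil

/-- `ρ_R(e)`. -/
def Env.applyR {P : Policy O L I D} (ρ : Env P) (e : Tm O (TVar P) (Var P) 0 0) : CTm O :=
  e.subst (fun a => (ρ.ty a).right) nil (fun x => (ρ.tm x).2) nil

/-- `ρ` is a full environment for `P` w.r.t. the observer `ζ`. -/
structure FullEnv (P : Policy O L I D) (ζ : L) (ρ : Env P) : Prop where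
  env : EnvFor P ζ ρ.ty
  plain : ∀ x h, IndVal P ζ (.arr (P.tlev (P.lvl x)) .int)
    (ρ.tm (.plain x h)).1 (ρ.tm (.plain x h)).2
  secret : ∀ x f l' h, IndVal P ζ (P.secretTy x f l' h)
    (ρ.tm (.secret x f l' h)).1 (ρ.tm (.secret x f l' h)).2
  decl : ∀ x f l' h, ρ.tm (.decl x f l' h) = (decImpl (P.dec f), decImpl (P.dec f))
  conv : ∀ x f l' h, ρ.tm (.conv x f l' h) = (convImpl, convImpl)
  comp : ∀ l, ρ.tm (.comp l) = (compImpl, compImpl)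
  convup : ∀ l l' h, ρ.tm (.convup l l' h) = (convupImpl, convupImpl)
  wrap : ∀ l, ρ.tm (.wrap l) = (wrapImpl, wrapImpl)

end Encoding

end MultiLevel

open MultiLevel

/-!
The statement is an instance of parametricity (the fundamental theorem of the logical relation,
`HasType.evals`): the two instances of a typed term under related environments evaluate to related
values. It is proved by induction on typing; its ingredients are the composition laws of
substitution, typing under substitution, and the compositionality `valRel_subst` of the logical
relation. For closed terms it gives termination, `CHasType.exists_value`.

What is left is that a full environment is related at every variable of the term context
(`FullEnv.valRel_ctx`). For inputs this is an assumption, so only the interfaces matter. All type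
variables `α_l` and `α_l^f` have the closed instance `unit`, and nothing is related at `α_l` if
the observer does not see `l`, so every function out of such an `α_l` is related to every other of
the right type. The result of `wrap_l` ignores its argument of type `α_l`; for `convup_{l,l'}` and
`conv_x` it remains to compare function types (`ValRel.arr_mono`). A declassifier `x_f` only
matters when the observer sees the target level; then either its input is related by `R_f`, which
says that applying `f` gives related results, or it is a pair of equal integers, and `f` is related
to itself by parametricity. Finally `comp_l` evaluates `g (x ⟨⟩)` as soon as it has received `x`
and `g`, so for observers that do not see `l` it has to be known that this application terminates,
although nothing relates the two sides.
-/

universe u' v'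

namespace MultiLevel

/-! ### Renaming and substitution in types -/

@[simp] theorem snoc_zero {T : Type u} {n : ℕ} (a : T) (σ : Fin n → T) : snoc a σ 0 = a := rfl

@[simp] theorem snoc_succ {T : Type u} {n : ℕ} (a : T) (σ : Fin n → T) (i : Fin n) :
    snoc a σ i.succ = σ i := rfl

theorem snoc_ext {T : Type u} {n : ℕ} {f g : Fin (n + 1) → T} (h0 : f 0 = g 0)
    (hs : ∀ i : Fin n, f i.succ = g i.succ) : f = g :=
  funext fun i => Fin.cases h0 hs i

theorem liftRen_comp {n m k : ℕ} (ξ' : Fin m → Fin k) (ξ : Fin n → Fin m) :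
    liftRen (ξ' ∘ ξ) = liftRen ξ' ∘ liftRen ξ :=
  snoc_ext rfl fun _ => rfl

theorem liftRen_id {n : ℕ} : liftRen (id : Fin n → Fin n) = id :=
  snoc_ext rfl fun _ => rfl

theorem snoc_comp_liftRen {T : Type u} {n m : ℕ} (a : T) (σ : Fin m → T) (ξ : Fin n → Fin m) :
    snoc a σ ∘ liftRen ξ = snoc a (σ ∘ ξ) :=
  snoc_ext rfl fun _ => rfl

theorem Ty.ren_ren {A : Type u} {n m k : ℕ} (t : Ty A n) (ξ : Fin n → Fin m)
    (ξ' : Fin m → Fin k) : (t.ren ξ).ren ξ' = t.ren (ξ' ∘ ξ) := by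
  induction t generalizing m k with
  | all t ih => simp only [Ty.ren, ih, liftRen_comp]
  | _ => simp only [Function.comp_apply, Ty.ren, *]

theorem Ty.ren_subst {A : Type u} {B : Type v} {n m k : ℕ} (t : Ty A n) (ξ : Fin n → Fin m)
    (δ : A → Ty B k) (σ : Fin m → Ty B k) :
    (t.ren ξ).subst δ σ = t.subst δ (σ ∘ ξ) := by
  induction t generalizing m k with
  | all t ih => simp only [Ty.ren, Ty.subst, ih, snoc_comp_liftRen]; rfl
  | _ => simp only [Function.comp_apply, Ty.ren, Ty.subst, *]

/-- Weakening commutes with renaming. -/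
theorem Ty.weaken_ren {A : Type u} {n m : ℕ} (t : Ty A n) (ξ : Fin n → Fin m) :
    t.weaken.ren (liftRen ξ) = (t.ren ξ).weaken := by
  simp only [Ty.weaken, Ty.ren_ren]; rfl

theorem Ty.subst_ren {A : Type u} {B : Type v} {n m k : ℕ} (t : Ty A n)
    (δ : A → Ty B m) (σ : Fin n → Ty B m) (ξ : Fin m → Fin k) :
    (t.subst δ σ).ren ξ = t.subst (fun a => (δ a).ren ξ) (fun i => (σ i).ren ξ) := by
  induction t generalizing m k with
  | all t ih =>
    simp only [Ty.ren, Ty.subst, ih, Ty.weaken_ren]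
    congr 2
    exact snoc_ext rfl fun i => Ty.weaken_ren _ _
  | _ => simp only [Ty.ren, Ty.subst, *]

/-- Substituting under a binder commutes with weakening. -/
theorem Ty.weaken_subst {A : Type u} {B : Type v} {n m : ℕ} (t : Ty A n)
    (δ : A → Ty B m) (σ : Fin n → Ty B m) :
    t.weaken.subst (fun a => (δ a).weaken) (snoc (.bvar 0) (fun i => (σ i).weaken)) =
      (t.subst δ σ).weaken := by
  simp only [Ty.weaken, Ty.ren_subst, Ty.subst_ren]; rfl

theorem Ty.subst_subst {A : Type u} {B : Type v} {C : Type w} {n m k : ℕ} (t : Ty A n)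
    (δ : A → Ty B m) (σ : Fin n → Ty B m) (δ' : B → Ty C k) (σ' : Fin m → Ty C k) :
    (t.subst δ σ).subst δ' σ' =
      t.subst (fun a => (δ a).subst δ' σ') (fun i => (σ i).subst δ' σ') := by
  induction t generalizing m k with
  | all t ih =>
    simp only [Ty.subst, ih, Ty.weaken_subst]
    congr 2
    exact snoc_ext rfl fun i => Ty.weaken_subst _ _ _
  | _ => simp only [Ty.subst, *]

theorem Ty.subst_id {A : Type u} {n : ℕ} (t : Ty A n) : t.subst Ty.fvar Ty.bvar = t := by
  induction t with
  | @all n t ih =>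
    have h : snoc (.bvar 0) (fun i => (Ty.bvar i : Ty A n).weaken) = Ty.bvar :=
      snoc_ext rfl fun _ => rfl
    simp only [Ty.subst, h]
    exact congrArg Ty.all ih
  | _ => simp only [Ty.subst, *]

theorem Ty.ren_id {A : Type u} {n : ℕ} (t : Ty A n) : t.ren id = t := by
  induction t with
  | all t ih => simp only [Ty.ren, liftRen_id, ih]
  | _ => simp only [id_eq, Ty.ren, *]

theorem Ty.weaken_subst_snoc {A : Type u} {B : Type v} {n m : ℕ} (t : Ty A n)
    (δ : A → Ty B m) (σ : Fin n → Ty B m) (s : Ty B m) :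
    t.weaken.subst δ (snoc s σ) = t.subst δ σ := by
  rw [Ty.weaken, Ty.ren_subst]; rfl

/-- Instantiating the binder after substituting under it is one simultaneous substitution. -/
theorem Ty.subst_lift_subst {A : Type u} {B : Type v} {n m : ℕ} (t : Ty A (n + 1))
    (δ : A → Ty B m) (σ : Fin n → Ty B m) (s : Ty B m) :
    (t.subst (fun a => (δ a).weaken) (snoc (.bvar 0) (fun i => (σ i).weaken))).inst s =
      t.subst δ (snoc s σ) := by
  simp only [Ty.inst, Ty.subst_subst, Ty.weaken_subst_snoc, Ty.subst_id]
  congr 1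
  exact snoc_ext rfl fun i => by
    simp only [snoc_succ, Ty.weaken_subst_snoc, Ty.subst_id]

theorem Ty.inst_subst {A : Type u} {B : Type v} {n m : ℕ} (t : Ty A (n + 1)) (s : Ty A n)
    (δ : A → Ty B m) (σ : Fin n → Ty B m) :
    (t.inst s).subst δ σ = t.subst δ (snoc (s.subst δ σ) σ) := by
  simp only [Ty.inst, Ty.subst_subst]
  congr 1
  exact snoc_ext rfl fun _ => rfl

theorem Ty.inst_ren {A : Type u} {n m : ℕ} (t : Ty A (n + 1)) (s : Ty A n)
    (ξ : Fin n → Fin m) :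
    (t.inst s).ren ξ = (t.ren (liftRen ξ)).inst (s.ren ξ) := by
  simp only [Ty.inst, Ty.subst_ren, Ty.ren_subst, snoc_comp_liftRen]
  congr 1
  exact snoc_ext rfl fun _ => rfl

/-! ### Renaming and substitution in terms -/

section TmSubst

variable {O : PrimOps} {A : Type u} {X : Type v} {B : Type w} {Y : Type z} {C : Type u'}
  {Z : Type v'}

theorem Tm.ren_ren {n n' n'' m m' m'' : ℕ} (e : Tm O A X n m) (ξ : Fin n → Fin n')
    (χ : Fin m → Fin m') (ξ' : Fin n' → Fin n'') (χ' : Fin m' → Fin m'') :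
    (e.ren ξ χ).ren ξ' χ' = e.ren (ξ' ∘ ξ) (χ' ∘ χ) := by
  induction e generalizing n' n'' m' m'' with
  | lam t e ih => simp only [Tm.ren, ih, liftRen_comp, Ty.ren_ren]
  | tlam e ih => simp only [Tm.ren, ih, liftRen_comp]
  | tapp e t ih => simp only [Tm.ren, ih, Ty.ren_ren]
  | _ => simp only [Function.comp_apply, Tm.ren, *]

theorem Tm.ren_subst {n n' n'' m m' m'' : ℕ} (e : Tm O A X n m) (ξ : Fin n → Fin n')
    (χ : Fin m → Fin m') (δ : A → Ty B n'') (σ : Fin n' → Ty B n'')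
    (γ : X → Tm O B Y n'' m'') (θ : Fin m' → Tm O B Y n'' m'') :
    (e.ren ξ χ).subst δ σ γ θ = e.subst δ (σ ∘ ξ) γ (θ ∘ χ) := by
  induction e generalizing n' n'' m' m'' with
  | lam t e ih => simp only [Tm.ren, Tm.subst, ih, snoc_comp_liftRen, Ty.ren_subst]; rfl
  | tlam e ih => simp only [Tm.ren, Tm.subst, ih, snoc_comp_liftRen]; rfl
  | tapp e t ih => simp only [Tm.ren, Tm.subst, ih, Ty.ren_subst]
  | _ => simp only [Function.comp_apply, Tm.ren, Tm.subst, *]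

theorem Tm.weaken_ren {n n' m m' : ℕ} (e : Tm O A X n m) (ξ : Fin n → Fin n')
    (χ : Fin m → Fin m') :
    (e.ren id Fin.succ).ren ξ (liftRen χ) = (e.ren ξ χ).ren id Fin.succ := by
  simp only [Tm.ren_ren]; rfl

theorem Tm.tweaken_ren {n n' m m' : ℕ} (e : Tm O A X n m) (ξ : Fin n → Fin n')
    (χ : Fin m → Fin m') :
    (e.ren Fin.succ id).ren (liftRen ξ) χ = (e.ren ξ χ).ren Fin.succ id := by
  simp only [Tm.ren_ren]; rfl

theorem Tm.subst_ren {n n' n'' m m' m'' : ℕ} (e : Tm O A X n m) (δ : A → Ty B n')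
    (σ : Fin n → Ty B n') (γ : X → Tm O B Y n' m') (θ : Fin m → Tm O B Y n' m')
    (ξ : Fin n' → Fin n'') (χ : Fin m' → Fin m'') :
    (e.subst δ σ γ θ).ren ξ χ = e.subst (fun a => (δ a).ren ξ) (fun i => (σ i).ren ξ)
      (fun x => (γ x).ren ξ χ) (fun i => (θ i).ren ξ χ) := by
  induction e generalizing n' n'' m' m'' with
  | lam t e ih =>
    simp only [Tm.ren, Tm.subst, ih, Ty.subst_ren, Tm.weaken_ren]
    congr 2
    exact snoc_ext rfl fun i => Tm.weaken_ren _ _ _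
  | tlam e ih =>
    simp only [Tm.ren, Tm.subst, ih, Tm.tweaken_ren, Ty.weaken_ren]
    congr 2
    exact snoc_ext rfl fun i => Ty.weaken_ren _ _
  | tapp e t ih => simp only [Tm.ren, Tm.subst, ih, Ty.subst_ren]
  | _ => simp only [Tm.ren, Tm.subst, *]

theorem Tm.weaken_subst {n n' m m' : ℕ} (e : Tm O A X n m) (δ : A → Ty B n')
    (σ : Fin n → Ty B n') (γ : X → Tm O B Y n' m') (θ : Fin m → Tm O B Y n' m') :
    (e.ren id Fin.succ).subst δ σ (fun x => (γ x).ren id Fin.succ)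
        (snoc (.bvar 0) (fun i => (θ i).ren id Fin.succ)) =
      (e.subst δ σ γ θ).ren id Fin.succ := by
  simp only [Tm.ren_subst, Tm.subst_ren, Ty.ren_id]; rfl

theorem Tm.tweaken_subst {n n' m m' : ℕ} (e : Tm O A X n m) (δ : A → Ty B n')
    (σ : Fin n → Ty B n') (γ : X → Tm O B Y n' m') (θ : Fin m → Tm O B Y n' m') :
    (e.ren Fin.succ id).subst (fun a => (δ a).weaken)
        (snoc (.bvar 0) (fun i => (σ i).weaken))
        (fun x => (γ x).ren Fin.succ id) (fun i => (θ i).ren Fin.succ id) =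
      (e.subst δ σ γ θ).ren Fin.succ id := by
  simp only [Tm.ren_subst, Tm.subst_ren]; rfl

theorem Tm.subst_subst {n n' n'' m m' m'' : ℕ} (e : Tm O A X n m) (δ : A → Ty B n')
    (σ : Fin n → Ty B n') (γ : X → Tm O B Y n' m') (θ : Fin m → Tm O B Y n' m')
    (δ' : B → Ty C n'') (σ' : Fin n' → Ty C n'')
    (γ' : Y → Tm O C Z n'' m'') (θ' : Fin m' → Tm O C Z n'' m'') :
    (e.subst δ σ γ θ).subst δ' σ' γ' θ' =
      e.subst (fun a => (δ a).subst δ' σ') (fun i => (σ i).subst δ' σ')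
        (fun x => (γ x).subst δ' σ' γ' θ') (fun i => (θ i).subst δ' σ' γ' θ') := by
  induction e generalizing n' n'' m' m'' with
  | lam t e ih =>
    simp only [Tm.subst, ih, Ty.subst_subst, Tm.weaken_subst]
    congr 2
    exact snoc_ext rfl fun i => Tm.weaken_subst _ _ _ _ _
  | tlam e ih =>
    simp only [Tm.subst, ih, Tm.tweaken_subst, Ty.weaken_subst]
    congr 2
    exact snoc_ext rfl fun i => Ty.weaken_subst _ _ _
  | tapp e t ih => simp only [Tm.subst, ih, Ty.subst_subst]
  | _ => simp only [Tm.subst, *]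

theorem Tm.subst_id {n m : ℕ} (e : Tm O A X n m) :
    e.subst Ty.fvar Ty.bvar Tm.fvar Tm.bvar = e := by
  induction e with
  | @lam n m t e ih =>
    have h : snoc (.bvar 0) (fun i => (Tm.bvar i : Tm O A X n m).ren id Fin.succ) = Tm.bvar :=
      snoc_ext rfl fun _ => rfl
    simp only [Tm.subst, h, Ty.subst_id]
    exact congrArg _ ih
  | @tlam n m e ih =>
    have h : snoc (.bvar 0) (fun i => (Ty.bvar i : Ty A n).weaken) = Ty.bvar :=
      snoc_ext rfl fun _ => rfl
    simp only [Tm.subst, h]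
    exact congrArg _ ih
  | tapp e t ih => simp only [Tm.subst, ih, Ty.subst_id]
  | _ => simp only [Tm.subst, *]

theorem Tm.weaken_inst {n m : ℕ} (e e' : Tm O A X n m) : (e.ren id Fin.succ).inst e' = e := by
  rw [Tm.inst, Tm.ren_subst]; exact Tm.subst_id e

theorem Tm.tweaken_tinst {n m : ℕ} (e : Tm O A X n m) (s : Ty A n) :
    (e.ren Fin.succ id).tinst s = e := by
  rw [Tm.tinst, Tm.ren_subst]; exact Tm.subst_id e

/-- The contractum of a `β`-redex whose body was substituted under the binder. -/
theorem Tm.subst_lift_inst {n n' m m' : ℕ} (e : Tm O A X n (m + 1)) (δ : A → Ty B n')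
    (σ : Fin n → Ty B n') (γ : X → Tm O B Y n' m') (θ : Fin m → Tm O B Y n' m')
    (a : Tm O B Y n' m') :
    (e.subst δ σ (fun x => (γ x).ren id Fin.succ)
      (snoc (.bvar 0) (fun i => (θ i).ren id Fin.succ))).inst a =
      e.subst δ σ γ (snoc a θ) := by
  rw [Tm.inst, Tm.subst_subst]
  simp only [Ty.subst_id]
  congr 1
  · exact funext fun x => Tm.weaken_inst _ _
  · exact snoc_ext rfl fun i => Tm.weaken_inst _ _

/-- The contractum of a type application whose body was substituted under the binder. -/
theorem Tm.subst_lift_tinst {n n' m m' : ℕ} (e : Tm O A X (n + 1) m) (δ : A → Ty B n')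
    (σ : Fin n → Ty B n') (γ : X → Tm O B Y n' m') (θ : Fin m → Tm O B Y n' m')
    (s : Ty B n') :
    (e.subst (fun a => (δ a).weaken) (snoc (.bvar 0) (fun i => (σ i).weaken))
      (fun x => (γ x).ren Fin.succ id) (fun i => (θ i).ren Fin.succ id)).tinst s =
      e.subst δ (snoc s σ) γ θ := by
  rw [Tm.tinst, Tm.subst_subst]
  simp only [Ty.weaken_subst_snoc, Ty.subst_id]
  congr 1
  · exact snoc_ext rfl fun i => by simp only [snoc_succ, Ty.weaken_subst_snoc, Ty.subst_id]
  · exact funext fun x => Tm.tweaken_tinst _ _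
  · exact funext fun x => Tm.tweaken_tinst _ _

end TmSubst

theorem Ty.subst_closed (t : CTy) (δ : Empty → CTy) (σ : Fin 0 → CTy) :
    t.subst δ σ = t := by
  rw [Subsingleton.elim δ Ty.fvar, Subsingleton.elim σ Ty.bvar, Ty.subst_id]

theorem Tm.subst_closed {O : PrimOps} (e : CTm O) (δ : Empty → CTy) (σ : Fin 0 → CTy)
    (γ : Empty → CTm O) (θ : Fin 0 → CTm O) : e.subst δ σ γ θ = e := by
  rw [Subsingleton.elim δ Ty.fvar, Subsingleton.elim σ Ty.bvar, Subsingleton.elim γ Tm.fvar,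
    Subsingleton.elim θ Tm.bvar, Tm.subst_id]

/-! ### Typing under renaming and substitution -/

section Typing

variable {O : PrimOps} {A : Type u} {X : Type v} {B : Type w} {Y : Type z}

theorem HasType.ren {n m n' m' : ℕ} {Γ : X → Ty A n} {Φ : Fin m → Ty A n} {e : Tm O A X n m}
    {t : Ty A n} (h : HasType Γ Φ e t) {Γ' : X → Ty A n'} {Φ' : Fin m' → Ty A n'}
    (ξ : Fin n → Fin n') (χ : Fin m → Fin m') (hΓ : ∀ x, Γ' x = (Γ x).ren ξ)
    (hΦ : ∀ i, Φ' (χ i) = (Φ i).ren ξ) : HasType Γ' Φ' (e.ren ξ χ) (t.ren ξ) := by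
  induction h generalizing n' m' with
  | fvar x => rw [← hΓ]; exact .fvar x
  | bvar i => rw [← hΦ]; exact .bvar _
  | lit k => exact .lit k
  | star => exact .star
  | op o _ _ ih₁ ih₂ => exact .op o (ih₁ ξ χ hΓ hΦ) (ih₂ ξ χ hΓ hΦ)
  | pair _ _ ih₁ ih₂ => exact .pair (ih₁ ξ χ hΓ hΦ) (ih₂ ξ χ hΓ hΦ)
  | fst _ ih => exact .fst (ih ξ χ hΓ hΦ)
  | snd _ ih => exact .snd (ih ξ χ hΓ hΦ)
  | lam _ ih => exact .lam (ih ξ (liftRen χ) hΓ fun i => Fin.cases rfl hΦ i)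
  | app _ _ ih₁ ih₂ => exact .app (ih₁ ξ χ hΓ hΦ) (ih₂ ξ χ hΓ hΦ)
  | tlam _ ih =>
    refine .tlam (ih (liftRen ξ) χ (fun x => ?_) (fun i => ?_))
    · rw [Ty.weaken_ren, hΓ]
    · rw [Ty.weaken_ren, hΦ]
  | tapp s _ ih => rw [Ty.inst_ren]; exact .tapp _ (ih ξ χ hΓ hΦ)

theorem HasType.subst {n m n' m' : ℕ} {Γ : X → Ty A n} {Φ : Fin m → Ty A n}
    {e : Tm O A X n m} {t : Ty A n} (h : HasType Γ Φ e t)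
    {Γ' : Y → Ty B n'} {Φ' : Fin m' → Ty B n'} {δ : A → Ty B n'} {σ : Fin n → Ty B n'}
    {γ : X → Tm O B Y n' m'} {θ : Fin m → Tm O B Y n' m'}
    (hγ : ∀ x, HasType Γ' Φ' (γ x) ((Γ x).subst δ σ))
    (hθ : ∀ i, HasType Γ' Φ' (θ i) ((Φ i).subst δ σ)) :
    HasType Γ' Φ' (e.subst δ σ γ θ) (t.subst δ σ) := by
  induction h generalizing n' m' with
  | fvar x => exact hγ x
  | bvar i => exact hθ i
  | lit k => exact .lit k
  | star => exact .star
  | op o _ _ ih₁ ih₂ => exact .op o (ih₁ hγ hθ) (ih₂ hγ hθ)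
  | pair _ _ ih₁ ih₂ => exact .pair (ih₁ hγ hθ) (ih₂ hγ hθ)
  | fst _ ih => exact .fst (ih hγ hθ)
  | snd _ ih => exact .snd (ih hγ hθ)
  | @lam _ _ Γ Φ e t₁ t₂ _ ih =>
    have weak : ∀ {e : Tm O B Y n' m'} {t : Ty B n'}, HasType Γ' Φ' e t →
        HasType Γ' (snoc (t₁.subst δ σ) Φ') (e.ren id Fin.succ) t := fun {e t} he => by
      have := he.ren (Γ' := Γ') (Φ' := snoc (t₁.subst δ σ) Φ') id Fin.succ
        (fun x => (Ty.ren_id _).symm) (fun i => (Ty.ren_id _).symm)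
      rwa [Ty.ren_id] at this
    exact .lam (ih (fun x => weak (hγ x))
      fun i => Fin.cases (.bvar 0) (fun i => weak (hθ i)) i)
  | app _ _ ih₁ ih₂ => exact .app (ih₁ hγ hθ) (ih₂ hγ hθ)
  | tlam _ ih =>
    refine .tlam (ih (fun x => ?_) (fun i => ?_))
    · rw [Ty.weaken_subst]
      exact (hγ x).ren _ _ (fun _ => rfl) (fun _ => rfl)
    · rw [Ty.weaken_subst]
      exact (hθ i).ren _ _ (fun _ => rfl) (fun _ => rfl)
  | tapp s _ ih =>
    rw [Ty.inst_subst, ← Ty.subst_lift_subst]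
    exact .tapp _ (ih hγ hθ)

end Typing

/-! ### Substitution in the logical relation -/

section Semantics

variable {O : PrimOps} {A : Type u} {X : Type v} {B : Type w}

theorem Interp.ext_of {J K : Interp O} (hl : J.left = K.left) (hr : J.right = K.right)
    (h : J.rel = K.rel) : J = K := by
  cases J; cases K; cases hl; cases hr; cases h; rfl

/-- Related values are closed values of the two instances of the type. -/
theorem ValRel.isValueOf {ρ : A → Interp O} {n : ℕ} {t : Ty A n} {η : Fin n → Interp O}
    {v w : CTm O} (h : ValRel ρ t η v w) :
    IsValueOf (t.left ρ η) v ∧ IsValueOf (t.right ρ η) w := by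
  induction t generalizing v w with
  | fvar a => exact (ρ a).wf _ _ h
  | bvar i => exact (η i).wf _ _ h
  | int => obtain ⟨k, rfl, rfl⟩ := h; exact ⟨⟨.lit k, .lit k⟩, ⟨.lit k, .lit k⟩⟩
  | unit => obtain ⟨rfl, rfl⟩ := h; exact ⟨⟨.star, .star⟩, ⟨.star, .star⟩⟩
  | prod s t ihs iht =>
    obtain ⟨v₁, v₂, w₁, w₂, rfl, rfl, h₁, h₂⟩ := h
    obtain ⟨⟨a₁, b₁⟩, a₁', b₁'⟩ := ihs h₁
    obtain ⟨⟨a₂, b₂⟩, a₂', b₂'⟩ := iht h₂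
    exact ⟨⟨.pair a₁ a₂, .pair b₁ b₂⟩, ⟨.pair a₁' a₂', .pair b₁' b₂'⟩⟩
  | arr s t => exact ⟨h.1, h.2.1⟩
  | all t => exact ⟨h.1, h.2.1⟩

/-- The interpretation of a type as a triple, made of its two closed instances and the logical
relation at it. -/
def Ty.sem (ρ : A → Interp O) {n : ℕ} (t : Ty A n) (η : Fin n → Interp O) : Interp O where
  left := t.left ρ η
  right := t.right ρ η
  rel := ValRel ρ t η
  wf _ _ h := h.isValueOf

theorem Ty.left_ren (ρ : A → Interp O) {n m : ℕ} (t : Ty A n) (ξ : Fin n → Fin m)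
    (η : Fin m → Interp O) : (t.ren ξ).left ρ η = t.left ρ (η ∘ ξ) :=
  Ty.ren_subst ..

theorem Ty.right_ren (ρ : A → Interp O) {n m : ℕ} (t : Ty A n) (ξ : Fin n → Fin m)
    (η : Fin m → Interp O) : (t.ren ξ).right ρ η = t.right ρ (η ∘ ξ) :=
  Ty.ren_subst ..

theorem valRel_ren (ρ : A → Interp O) {n m : ℕ} (t : Ty A n) (ξ : Fin n → Fin m)
    (η : Fin m → Interp O) : ValRel ρ (t.ren ξ) η = ValRel ρ t (η ∘ ξ) := by
  induction t generalizing m with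
  | arr s t ihs iht =>
    have hl := Ty.left_ren ρ (.arr s t) ξ η
    have hr := Ty.right_ren ρ (.arr s t) ξ η
    simp only [Ty.ren] at hl hr
    funext v w
    simp only [Ty.ren, ValRel, ihs, iht, hl, hr, Ty.left_ren, Ty.right_ren]
  | all t ih =>
    have hl := Ty.left_ren ρ (.all t) ξ η
    have hr := Ty.right_ren ρ (.all t) ξ η
    simp only [Ty.ren] at hl hr
    funext v w
    simp only [Ty.ren, ValRel, ih, hl, hr, Ty.left_ren, Ty.right_ren, snoc_comp_liftRen]
  | prod s t ihs iht => funext v w; simp only [Ty.ren, ValRel, ihs, iht]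
  | _ => funext v w; simp only [Ty.ren, ValRel, Function.comp]

theorem Ty.sem_weaken (ρ : A → Interp O) {n : ℕ} (t : Ty A n) (J : Interp O)
    (η : Fin n → Interp O) : t.weaken.sem ρ (snoc J η) = t.sem ρ η :=
  Interp.ext_of (Ty.left_ren ..) (Ty.right_ren ..) (valRel_ren ..)

theorem valRel_weaken (ρ : A → Interp O) {n : ℕ} (t : Ty A n) (J : Interp O)
    (η : Fin n → Interp O) : ValRel ρ t.weaken (snoc J η) = ValRel ρ t η :=
  valRel_ren ..

theorem Ty.left_subst (ρ : B → Interp O) {n m : ℕ} (t : Ty A n) (δ : A → Ty B m)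
    (σ : Fin n → Ty B m) (η : Fin m → Interp O) :
    (t.subst δ σ).left ρ η =
      t.left (fun a => (δ a).sem ρ η) (fun i => (σ i).sem ρ η) :=
  Ty.subst_subst ..

theorem Ty.right_subst (ρ : B → Interp O) {n m : ℕ} (t : Ty A n) (δ : A → Ty B m)
    (σ : Fin n → Ty B m) (η : Fin m → Interp O) :
    (t.subst δ σ).right ρ η =
      t.right (fun a => (δ a).sem ρ η) (fun i => (σ i).sem ρ η) :=
  Ty.subst_subst ..

/-- Compositionality: substituting types amounts to interpreting the variables by the
interpretations of those types. -/
theorem valRel_subst (ρ : B → Interp O) {n m : ℕ} (t : Ty A n) (δ : A → Ty B m)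
    (σ : Fin n → Ty B m) (η : Fin m → Interp O) :
    ValRel ρ (t.subst δ σ) η =
      ValRel (fun a => (δ a).sem ρ η) t (fun i => (σ i).sem ρ η) := by
  induction t generalizing m with
  | arr s t ihs iht =>
    have hl := Ty.left_subst ρ (.arr s t) δ σ η
    have hr := Ty.right_subst ρ (.arr s t) δ σ η
    simp only [Ty.subst] at hl hr
    funext v w
    simp only [Ty.subst, ValRel, ihs, iht, hl, hr, Ty.left_subst, Ty.right_subst]
  | all t ih =>
    have hl := Ty.left_subst ρ (.all t) δ σ η
    have hr := Ty.right_subst ρ (.all t) δ σ η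
    simp only [Ty.subst] at hl hr
    have hs : ∀ J : Interp O, (fun i => (snoc (.bvar 0) (fun i => (σ i).weaken) i).sem ρ
        (snoc J η)) = snoc J (fun i => (σ i).sem ρ η) := fun J =>
      snoc_ext rfl fun i => Ty.sem_weaken ..
    funext v w
    simp only [Ty.subst, ValRel, ih, hl, hr, Ty.left_subst, Ty.right_subst, Ty.sem_weaken, hs]
  | prod s t ihs iht => funext v w; simp only [Ty.subst, ValRel, ihs, iht]
  | _ => funext v w; simp only [Ty.subst, ValRel, Ty.sem]

theorem valRel_inst (ρ : A → Interp O) {n : ℕ} (t : Ty A (n + 1)) (s : Ty A n)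
    (η : Fin n → Interp O) :
    ValRel ρ (t.inst s) η = ValRel ρ t (snoc (s.sem ρ η) η) := by
  rw [Ty.inst, valRel_subst]
  congr 1
  exact snoc_ext rfl fun _ => rfl

theorem valRel_embed (ρ : A → Interp O) (t : CTy) :
    ValRel ρ (t.embed : Ty A 0) nil = ValRel (emptyEnv : Empty → Interp O) t nil := by
  rw [Ty.embed, valRel_subst]
  congr 1 <;> exact Subsingleton.elim _ _

/-! ### Evaluation to related values -/

/-- Both terms evaluate, to values related by `R`. -/
def Evals (R : CTm O → CTm O → Prop) (e₁ e₂ : CTm O) : Prop :=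
  ∃ v₁ v₂ : CTm O, IsValue v₁ ∧ IsValue v₂ ∧ Steps e₁ v₁ ∧ Steps e₂ v₂ ∧ R v₁ v₂

theorem ValRel.evals {ρ : A → Interp O} {n : ℕ} {t : Ty A n} {η : Fin n → Interp O}
    {v w : CTm O} (h : ValRel ρ t η v w) : Evals (ValRel ρ t η) v w :=
  ⟨v, w, h.isValueOf.1.1, h.isValueOf.2.1, .refl, .refl, h⟩

theorem Evals.of_steps {R : CTm O → CTm O → Prop} {e₁ e₂ e₁' e₂' : CTm O}
    (h : Evals R e₁' e₂') (h₁ : Steps e₁ e₁') (h₂ : Steps e₂ e₂') : Evals R e₁ e₂ := by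
  obtain ⟨v₁, v₂, a₁, a₂, s₁, s₂, hR⟩ := h
  exact ⟨v₁, v₂, a₁, a₂, h₁.trans s₁, h₂.trans s₂, hR⟩

theorem Evals.of_step {R : CTm O → CTm O → Prop} {e₁ e₂ e₁' e₂' : CTm O}
    (h : Evals R e₁' e₂') (h₁ : Step e₁ e₁') (h₂ : Step e₂ e₂') : Evals R e₁ e₂ :=
  h.of_steps (.single h₁) (.single h₂)

theorem Evals.mono {R S : CTm O → CTm O → Prop} {e₁ e₂ : CTm O} (h : Evals R e₁ e₂)
    (hRS : ∀ v w, R v w → S v w) : Evals S e₁ e₂ := by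
  obtain ⟨v₁, v₂, a₁, a₂, s₁, s₂, hR⟩ := h
  exact ⟨v₁, v₂, a₁, a₂, s₁, s₂, hRS _ _ hR⟩

/-- Evaluation may be carried out under an evaluation context `E`, here given by functions
that preserve reduction. -/
theorem Evals.bind {R S : CTm O → CTm O → Prop} {e₁ e₂ : CTm O} (h : Evals R e₁ e₂)
    {E₁ E₂ : CTm O → CTm O} (hE₁ : ∀ a b, Step a b → Step (E₁ a) (E₁ b))
    (hE₂ : ∀ a b, Step a b → Step (E₂ a) (E₂ b))
    (hS : ∀ v w, IsValue v → IsValue w → R v w → Evals S (E₁ v) (E₂ w)) :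
    Evals S (E₁ e₁) (E₂ e₂) := by
  obtain ⟨v₁, v₂, a₁, a₂, s₁, s₂, hR⟩ := h
  exact (hS _ _ a₁ a₂ hR).of_steps (s₁.lift E₁ hE₁) (s₂.lift E₂ hE₂)

theorem Evals.app {ρ : A → Interp O} {n : ℕ} {s t : Ty A n} {η : Fin n → Interp O}
    {f₁ f₂ e₁ e₂ : CTm O} (hf : Evals (ValRel ρ (.arr s t) η) f₁ f₂)
    (he : Evals (ValRel ρ s η) e₁ e₂) : Evals (ValRel ρ t η) (.app f₁ e₁) (.app f₂ e₂) :=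
  hf.bind (E₁ := fun f => .app f e₁) (E₂ := fun f => .app f e₂) (fun _ _ => .app_left)
    (fun _ _ => .app_left) fun f₁ f₂ hv₁ hv₂ hf =>
      he.bind (E₁ := .app f₁) (E₂ := .app f₂) (fun _ _ => .app_right hv₁)
        (fun _ _ => .app_right hv₂) fun v w _ _ h => (hf.2.2 v w h).2.2

/-- An application is evaluated by evaluating the function first. -/
theorem Steps.exists_value_of_app {f u v : CTm O} (h : Steps (.app f u) v) (hv : IsValue v) :
    ∃ g, IsValue g ∧ Steps f g ∧ Steps (.app g u) v := by
  generalize ha : Tm.app f u = a at h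
  induction h using Relation.ReflTransGen.head_induction_on generalizing f u with
  | refl => subst ha; cases hv
  | head hs hrest ih =>
    subst ha
    cases hs with
    | beta hu => exact ⟨_, .lam _ _, .refl, .head (.beta hu) hrest⟩
    | app_left hf =>
      obtain ⟨g, hg, s, s'⟩ := ih rfl
      exact ⟨g, hg, .head hf s, s'⟩
    | app_right hf hu => exact ⟨_, hf, .refl, .head (.app_right hf hu) hrest⟩

/-- In an application, the argument may be evaluated beforehand. -/
theorem Evals.app_of_arg {R : CTm O → CTm O → Prop} {f₁ f₂ e₁ e₂ u₁ u₂ : CTm O}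
    (h : Evals R (.app f₁ u₁) (.app f₂ u₂)) (h₁ : Steps e₁ u₁) (h₂ : Steps e₂ u₂) :
    Evals R (.app f₁ e₁) (.app f₂ e₂) := by
  have lift : ∀ {f e u v : CTm O}, IsValue v → Steps (.app f u) v → Steps e u →
      Steps (.app f e) v := fun {f e u v} hv h hu => by
    obtain ⟨g, hg, s, s'⟩ := Steps.exists_value_of_app h hv
    exact (s.lift (fun f => Tm.app f e) fun _ _ => Step.app_left).trans
      ((hu.lift (Tm.app g) fun _ _ => Step.app_right hg).trans s')
  obtain ⟨v₁, v₂, a₁, a₂, s₁, s₂, hR⟩ := h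
  exact ⟨v₁, v₂, a₁, a₂, lift a₁ s₁ h₁, lift a₂ s₂ h₂, hR⟩

/-! ### Related abstractions -/

theorem HasType.lam_inv {n m : ℕ} {Γ : X → Ty A n} {Φ : Fin m → Ty A n}
    {e : Tm O A X n (m + 1)} {a s t : Ty A n} (h : HasType Γ Φ (.lam a e) (.arr s t)) :
    HasType Γ (snoc s Φ) e t := by
  cases h; assumption

theorem HasType.tlam_inv {n m : ℕ} {Γ : X → Ty A n} {Φ : Fin m → Ty A n}
    {e : Tm O A X (n + 1) m} {t : Ty A (n + 1)} (h : HasType Γ Φ (.tlam e) (.all t)) :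
    HasType (fun x => (Γ x).weaken) (fun i => (Φ i).weaken) e t := by
  cases h; assumption

theorem CHasType.inst {b : Tm O Empty Empty 0 1} {a s t : CTy} {v : CTm O}
    (h : CHasType (.lam a b) (.arr s t)) (hv : CHasType v s) : CHasType (b.inst v) t := by
  have := h.lam_inv.subst (Γ' := fun x : Empty => x.elim) (Φ' := nil) (δ := Ty.fvar)
    (σ := Ty.bvar) (γ := Tm.fvar) (θ := snoc v Tm.bvar) (fun x => x.elim)
    (fun i => Fin.cases (by rw [Ty.subst_id]; exact hv) (fun i => i.elim0) i)
  rwa [Ty.subst_id] at this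

theorem CHasType.tinst {b : Tm O Empty Empty 1 0} {t : Ty Empty 1} (s : CTy)
    (h : CHasType (.tlam b) (.all t)) : CHasType (b.tinst s) (t.inst s) :=
  h.tlam_inv.subst (fun x => x.elim) (fun i => i.elim0)

variable {A₁ A₂ : Type*} {X₁ X₂ : Type*} {n₁ m₁ n₂ m₂ : ℕ}
  {δ₁ : A₁ → CTy} {σ₁ : Fin n₁ → CTy} {γ₁ : X₁ → CTm O} {θ₁ : Fin m₁ → CTm O}
  {δ₂ : A₂ → CTy} {σ₂ : Fin n₂ → CTy} {γ₂ : X₂ → CTm O} {θ₂ : Fin m₂ → CTm O}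

/-- Closed instances of `λ`-abstractions are related if their bodies evaluate to related values
whenever the bound variables are bound to related values. The typing of the bodies is made
available, so that nested abstractions are typed only once. -/
theorem valRel_lam {ρ : A → Interp O} {n : ℕ} {s t : Ty A n} {η : Fin n → Interp O}
    {a₁ : Ty A₁ n₁} {a₂ : Ty A₂ n₂} {b₁ : Tm O A₁ X₁ n₁ (m₁ + 1)} {b₂ : Tm O A₂ X₂ n₂ (m₂ + 1)}
    (h₁ : CHasType ((Tm.lam a₁ b₁).subst δ₁ σ₁ γ₁ θ₁) ((Ty.arr s t).left ρ η))
    (h₂ : CHasType ((Tm.lam a₂ b₂).subst δ₂ σ₂ γ₂ θ₂) ((Ty.arr s t).right ρ η))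
    (h : ∀ v w, ValRel ρ s η v w →
      CHasType (b₁.subst δ₁ σ₁ γ₁ (snoc v θ₁)) (t.left ρ η) →
      CHasType (b₂.subst δ₂ σ₂ γ₂ (snoc w θ₂)) (t.right ρ η) →
      Evals (ValRel ρ t η) (b₁.subst δ₁ σ₁ γ₁ (snoc v θ₁)) (b₂.subst δ₂ σ₂ γ₂ (snoc w θ₂))) :
    ValRel ρ (.arr s t) η ((Tm.lam a₁ b₁).subst δ₁ σ₁ γ₁ θ₁)
      ((Tm.lam a₂ b₂).subst δ₂ σ₂ γ₂ θ₂) := by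
  refine ⟨⟨.lam _ _, h₁⟩, ⟨.lam _ _, h₂⟩, fun v w hvw => ?_⟩
  obtain ⟨⟨hv, tv⟩, hw, tw⟩ := hvw.isValueOf
  refine ⟨h₁.app tv, h₂.app tw, ?_⟩
  have i₁ := CHasType.inst h₁ tv
  have i₂ := CHasType.inst h₂ tw
  rw [Tm.subst_lift_inst] at i₁ i₂
  have := h v w hvw i₁ i₂
  rw [← Tm.subst_lift_inst (a := v), ← Tm.subst_lift_inst (a := w)] at this
  exact this.of_step (.beta hv) (.beta hw)

/-- Closed instances of `Λ`-abstractions are related if their bodies evaluate to related values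
under every interpretation of the bound type variable. -/
theorem valRel_tlam {ρ : A → Interp O} {n : ℕ} {t : Ty A (n + 1)} {η : Fin n → Interp O}
    {b₁ : Tm O A₁ X₁ (n₁ + 1) m₁} {b₂ : Tm O A₂ X₂ (n₂ + 1) m₂}
    (h₁ : CHasType ((Tm.tlam b₁).subst δ₁ σ₁ γ₁ θ₁) ((Ty.all t).left ρ η))
    (h₂ : CHasType ((Tm.tlam b₂).subst δ₂ σ₂ γ₂ θ₂) ((Ty.all t).right ρ η))
    (h : ∀ J : Interp O,
      CHasType (b₁.subst δ₁ (snoc J.left σ₁) γ₁ θ₁) (t.left ρ (snoc J η)) →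
      CHasType (b₂.subst δ₂ (snoc J.right σ₂) γ₂ θ₂) (t.right ρ (snoc J η)) →
      Evals (ValRel ρ t (snoc J η)) (b₁.subst δ₁ (snoc J.left σ₁) γ₁ θ₁)
        (b₂.subst δ₂ (snoc J.right σ₂) γ₂ θ₂)) :
    ValRel ρ (.all t) η ((Tm.tlam b₁).subst δ₁ σ₁ γ₁ θ₁)
      ((Tm.tlam b₂).subst δ₂ σ₂ γ₂ θ₂) := by
  refine ⟨⟨.tlam _, h₁⟩, ⟨.tlam _, h₂⟩, fun J => ?_⟩
  have hl : t.left ρ (snoc J η) = (t.subst (fun a => (ρ a).left.weaken)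
      (snoc (.bvar 0) (fun i => (η i).left.weaken))).inst J.left := by
    rw [Ty.subst_lift_subst, Ty.left]
    congr 1
    exact snoc_ext rfl fun _ => rfl
  have hr : t.right ρ (snoc J η) = (t.subst (fun a => (ρ a).right.weaken)
      (snoc (.bvar 0) (fun i => (η i).right.weaken))).inst J.right := by
    rw [Ty.subst_lift_subst, Ty.right]
    congr 1
    exact snoc_ext rfl fun _ => rfl
  have i₁ := CHasType.tinst J.left h₁
  have i₂ := CHasType.tinst J.right h₂
  rw [Tm.subst_lift_tinst, ← hl] at i₁
  rw [Tm.subst_lift_tinst, ← hr] at i₂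
  have := h J i₁ i₂
  rw [← Tm.subst_lift_tinst (s := J.left), ← Tm.subst_lift_tinst (s := J.right)] at this
  refine ⟨?_, ?_, this.of_step .tbeta .tbeta⟩
  · rw [hl]; exact h₁.tapp _
  · rw [hr]; exact h₂.tapp _

/-! ### Parametricity -/

theorem HasType.left {n m : ℕ} {Γ : X → Ty A n} {Φ : Fin m → Ty A n} {e : Tm O A X n m}
    {t : Ty A n} (h : HasType Γ Φ e t) {ρ : A → Interp O} {η : Fin n → Interp O}
    {γ₁ γ₂ : X → CTm O} {θ₁ θ₂ : Fin m → CTm O}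
    (hγ : ∀ x, ValRel ρ (Γ x) η (γ₁ x) (γ₂ x)) (hθ : ∀ i, ValRel ρ (Φ i) η (θ₁ i) (θ₂ i)) :
    CHasType (e.subst (fun a => (ρ a).left) (fun i => (η i).left) γ₁ θ₁) (t.left ρ η) :=
  h.subst (fun x => (hγ x).isValueOf.1.2) (fun i => (hθ i).isValueOf.1.2)

theorem HasType.right {n m : ℕ} {Γ : X → Ty A n} {Φ : Fin m → Ty A n} {e : Tm O A X n m}
    {t : Ty A n} (h : HasType Γ Φ e t) {ρ : A → Interp O} {η : Fin n → Interp O}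
    {γ₁ γ₂ : X → CTm O} {θ₁ θ₂ : Fin m → CTm O}
    (hγ : ∀ x, ValRel ρ (Γ x) η (γ₁ x) (γ₂ x)) (hθ : ∀ i, ValRel ρ (Φ i) η (θ₁ i) (θ₂ i)) :
    CHasType (e.subst (fun a => (ρ a).right) (fun i => (η i).right) γ₂ θ₂) (t.right ρ η) :=
  h.subst (fun x => (hγ x).isValueOf.2.2) (fun i => (hθ i).isValueOf.2.2)

/-- Parametricity, evaluation part: the two closed instances of a typed term under related
assignments evaluate to related values. -/
theorem HasType.evals {n m : ℕ} {Γ : X → Ty A n} {Φ : Fin m → Ty A n} {e : Tm O A X n m}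
    {t : Ty A n} (h : HasType Γ Φ e t) {ρ : A → Interp O} {η : Fin n → Interp O}
    {γ₁ γ₂ : X → CTm O} {θ₁ θ₂ : Fin m → CTm O}
    (hγ : ∀ x, ValRel ρ (Γ x) η (γ₁ x) (γ₂ x)) (hθ : ∀ i, ValRel ρ (Φ i) η (θ₁ i) (θ₂ i)) :
    Evals (ValRel ρ t η) (e.subst (fun a => (ρ a).left) (fun i => (η i).left) γ₁ θ₁)
      (e.subst (fun a => (ρ a).right) (fun i => (η i).right) γ₂ θ₂) := by
  induction h with
  | fvar x => exact (hγ x).evals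
  | bvar i => exact (hθ i).evals
  | lit k => exact ⟨.lit k, .lit k, .lit k, .lit k, .refl, .refl, k, rfl, rfl⟩
  | star => exact ⟨.star, .star, .star, .star, .refl, .refl, rfl, rfl⟩
  | op o _ _ ih₁ ih₂ =>
    refine (ih₁ hγ hθ).bind (E₁ := fun a => .op o a _) (E₂ := fun a => .op o a _)
      (fun _ _ => .op_left) (fun _ _ => .op_left) ?_
    rintro _ _ - - ⟨j, rfl, rfl⟩
    refine (ih₂ hγ hθ).bind (E₁ := fun a => .op o (.lit j) a) (E₂ := fun a => .op o (.lit j) a)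
      (fun _ _ => .op_right (.lit j)) (fun _ _ => .op_right (.lit j)) ?_
    rintro _ _ - - ⟨k, rfl, rfl⟩
    exact Evals.of_step ⟨_, _, .lit _, .lit _, .refl, .refl, _, rfl, rfl⟩ .op_lit .op_lit
  | pair _ _ ih₁ ih₂ =>
    refine (ih₁ hγ hθ).bind (E₁ := fun a => .pair a _) (E₂ := fun a => .pair a _)
      (fun _ _ => .pair_left) (fun _ _ => .pair_left) fun v₁ w₁ hv₁ hw₁ h₁ => ?_
    refine (ih₂ hγ hθ).bind (E₁ := fun a => .pair v₁ a) (E₂ := fun a => .pair w₁ a)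
      (fun _ _ => .pair_right hv₁) (fun _ _ => .pair_right hw₁) fun v₂ w₂ hv₂ hw₂ h₂ => ?_
    exact ⟨_, _, .pair hv₁ hv₂, .pair hw₁ hw₂, .refl, .refl, v₁, v₂, w₁, w₂, rfl, rfl, h₁, h₂⟩
  | fst _ ih =>
    refine (ih hγ hθ).bind (E₁ := .fst) (E₂ := .fst) (fun _ _ => .fst) (fun _ _ => .fst) ?_
    rintro _ _ - - ⟨v₁, v₂, w₁, w₂, rfl, rfl, h₁, h₂⟩
    exact h₁.evals.of_step (.fst_pair h₁.isValueOf.1.1 h₂.isValueOf.1.1)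
      (.fst_pair h₁.isValueOf.2.1 h₂.isValueOf.2.1)
  | snd _ ih =>
    refine (ih hγ hθ).bind (E₁ := .snd) (E₂ := .snd) (fun _ _ => .snd) (fun _ _ => .snd) ?_
    rintro _ _ - - ⟨v₁, v₂, w₁, w₂, rfl, rfl, h₁, h₂⟩
    exact h₂.evals.of_step (.snd_pair h₁.isValueOf.1.1 h₂.isValueOf.1.1)
      (.snd_pair h₁.isValueOf.2.1 h₂.isValueOf.2.1)
  | lam he ih =>
    refine (valRel_lam (he.lam.left hγ hθ) (he.lam.right hγ hθ) fun v w hvw _ _ => ?_).evals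
    exact ih hγ fun i => Fin.cases hvw hθ i
  | app _ _ ih₁ ih₂ => exact (ih₁ hγ hθ).app (ih₂ hγ hθ)
  | tlam he ih =>
    refine (valRel_tlam (he.tlam.left hγ hθ) (he.tlam.right hγ hθ) fun J _ _ => ?_).evals
    have := ih (η := snoc J _) (fun x => by rw [valRel_weaken]; exact hγ x)
      (fun i => by rw [valRel_weaken]; exact hθ i)
    convert this using 2 <;> exact snoc_ext rfl fun _ => rfl
  | @tapp _ _ _ _ _ t s _ ih =>
    rw [valRel_inst]
    exact (ih hγ hθ).bind (E₁ := fun a => .tapp a _) (E₂ := fun a => .tapp a _)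
      (fun _ _ => .tapp) (fun _ _ => .tapp) fun v w _ _ h => (h.2.2 (s.sem _ _)).2.2

/-- A typed closed term is related to itself. -/
theorem CHasType.evals {e : CTm O} {t : CTy} (h : CHasType e t) :
    Evals (ValRel emptyEnv t nil) e e := by
  have := HasType.evals h (ρ := emptyEnv) (η := nil) (γ₁ := fun x : Empty => x.elim)
    (γ₂ := fun x : Empty => x.elim) (θ₁ := nil) (θ₂ := nil) (fun x => x.elim) (fun i => i.elim0)
  rwa [Tm.subst_closed, Tm.subst_closed] at this

/-- Every typed closed term evaluates to a value of its type. -/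
theorem CHasType.exists_value {e : CTm O} {t : CTy} (h : CHasType e t) :
    ∃ v, IsValueOf t v ∧ Steps e v := by
  obtain ⟨v, _, _, _, hs, _, hR⟩ := h.evals
  have := hR.isValueOf.1
  rw [Ty.left, Ty.subst_closed] at this
  exact ⟨v, this, hs⟩

end Semantics

/-! ### Relatedness of the interfaces -/

section Interfaces

variable {O : PrimOps}

@[simp] theorem snoc_one {T : Type u} {n : ℕ} (a : T) (σ : Fin (n + 1) → T) :
    snoc a σ 1 = σ 0 := rfl

/-- Function types are contravariant in the domain, as long as the closed instances do not
change. The codomain may also change if it does so covariantly; that condition is vacuous if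
nothing is related at the new domain. -/
theorem ValRel.arr_mono {A : Type u} {ρ : A → Interp O} {n : ℕ} {s t s' t' : Ty A n}
    {η : Fin n → Interp O} {v w : CTm O} (h : ValRel ρ (.arr s t) η v w)
    (hl : (Ty.arr s t).left ρ η = (Ty.arr s' t').left ρ η)
    (hr : (Ty.arr s t).right ρ η = (Ty.arr s' t').right ρ η)
    (hs : ∀ v w, ValRel ρ s' η v w →
      ValRel ρ s η v w ∧ ∀ v w, ValRel ρ t η v w → ValRel ρ t' η v w) :
    ValRel ρ (.arr s' t') η v w := by
  refine ⟨hl ▸ h.1, hr ▸ h.2.1, fun v' w' h' => ?_⟩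
  obtain ⟨h₁, h₂⟩ := hs v' w' h'
  obtain ⟨-, -, he⟩ := h.2.2 v' w' h₁
  obtain ⟨hv', hw'⟩ := h'.isValueOf
  have tv : CHasType v ((Ty.arr s' t').left ρ η) := hl ▸ h.1.2
  have tw : CHasType w ((Ty.arr s' t').right ρ η) := hr ▸ h.2.1.2
  exact ⟨tv.app hv'.2, tw.app hw'.2, Evals.mono he h₂⟩

theorem Tm.embed_subst {A : Type u} {X : Type v} {n m : ℕ} (e : CTm O) (δ : A → CTy)
    (σ : Fin n → CTy) (γ : X → CTm O) (θ : Fin m → CTm O) :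
    (e.embed : Tm O A X n m).subst δ σ γ θ = e := by
  rw [Tm.embed, Tm.subst_subst, Tm.subst_closed]

theorem Ty.embed_subst {A : Type u} {n : ℕ} (t : CTy) (δ : A → CTy) (σ : Fin n → CTy) :
    (t.embed : Ty A n).subst δ σ = t := by
  rw [Ty.embed, Ty.subst_subst, Ty.subst_closed]

theorem CHasType.embed {e : CTm O} {t : CTy} (h : CHasType e t) {m : ℕ} (Φ : Fin m → CTy) :
    HasType (fun x : Empty => x.elim) Φ (e.embed : Tm O Empty Empty 0 m) t := by
  have := HasType.subst h (Γ' := fun x : Empty => x.elim) (Φ' := Φ)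
    (δ := fun a => a.elim) (σ := nil) (γ := fun x => x.elim) (θ := nil)
    (fun x => x.elim) (fun i => i.elim0)
  rwa [Ty.subst_closed] at this

theorem isValueOf_unit_star : IsValueOf .unit (.star : CTm O) := ⟨.star, .star⟩

variable {L : Type u} [Lattice L] {I : Type v} {D : Type w} {P : Policy O L I D} {ζ : L}
  {ρ : TVar P → Interp O}

namespace EnvFor

theorem left_lev (h : EnvFor P ζ ρ) (l : L) : (ρ (.lev l)).left = .unit := by
  by_cases hl : l ≤ ζ
  · rw [h.lev_low l hl]; rfl
  · rw [h.lev_high l hl]; rfl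

theorem right_lev (h : EnvFor P ζ ρ) (l : L) : (ρ (.lev l)).right = .unit := by
  by_cases hl : l ≤ ζ
  · rw [h.lev_low l hl]; rfl
  · rw [h.lev_high l hl]; rfl

theorem left_key (h : EnvFor P ζ ρ) (l : L) (f : D) (hx) : (ρ (.key l f hx)).left = .unit := by
  obtain ⟨x, l', hF, rfl⟩ := hx
  by_cases hl : P.lvl x ≤ ζ ∨ l' ≤ ζ
  · rw [h.key_low x f l' hF hl]; rfl
  · rw [h.key_high x f l' hF hl]; rfl

theorem right_key (h : EnvFor P ζ ρ) (l : L) (f : D) (hx) :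
    (ρ (.key l f hx)).right = .unit := by
  obtain ⟨x, l', hF, rfl⟩ := hx
  by_cases hl : P.lvl x ≤ ζ ∨ l' ≤ ζ
  · rw [h.key_low x f l' hF hl]; rfl
  · rw [h.key_high x f l' hF hl]; rfl

theorem left_val (h : EnvFor P ζ ρ) (f : D) (hx) : (ρ (.val f hx)).left = .int := by
  obtain ⟨x, l', hF⟩ := hx
  by_cases hl : P.lvl x ≤ ζ
  · rw [h.val_low x f l' hF hl]; rfl
  · by_cases hl' : l' ≤ ζ
    · rw [h.val_mid x f l' hF hl' hl]; rfl
    · rw [h.val_high x f l' hF hl' hl]; rfl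

theorem right_val (h : EnvFor P ζ ρ) (f : D) (hx) : (ρ (.val f hx)).right = .int := by
  obtain ⟨x, l', hF⟩ := hx
  by_cases hl : P.lvl x ≤ ζ
  · rw [h.val_low x f l' hF hl]; rfl
  · by_cases hl' : l' ≤ ζ
    · rw [h.val_mid x f l' hF hl' hl]; rfl
    · rw [h.val_high x f l' hF hl' hl]; rfl

/-- Nothing is related at `α_l` unless the observer sees the level `l`. -/
theorem le_of_rel_lev (h : EnvFor P ζ ρ) {l : L} {v w : CTm O} (hvw : (ρ (.lev l)).rel v w) :
    l ≤ ζ := by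
  by_contra hl
  rw [h.lev_high l hl] at hvw
  exact hvw

theorem rel_lev (h : EnvFor P ζ ρ) {l : L} (hl : l ≤ ζ) {v w : CTm O}
    (hv : IsValueOf .unit v) (hw : IsValueOf .unit w) : (ρ (.lev l)).rel v w := by
  rw [h.lev_low l hl]; exact ⟨hv, hw⟩

theorem rel_key (h : EnvFor P ζ ρ) {x : I} {f : D} {l' : L} (hF : P.F x = some (f, l'))
    (hl : P.lvl x ≤ ζ ∨ l' ≤ ζ) {v w : CTm O} (hv : IsValueOf .unit v)
    (hw : IsValueOf .unit w) : (ρ (.key (P.lvl x) f ⟨x, l', hF, rfl⟩)).rel v w := by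
  rw [h.key_low x f l' hF hl]; exact ⟨hv, hw⟩

theorem valRel_wrapImpl (h : EnvFor P ζ ρ) (l : L) :
    ValRel ρ (P.ctx (.wrap l)) nil wrapImpl wrapImpl := by
  have hl : CHasType (wrapImpl : CTm O) ((P.ctx (.wrap l)).left ρ nil) := by
    simp only [Policy.ctx, Policy.tlev, Ty.left, Ty.subst, h.left_lev, Ty.weaken, Ty.ren,
      snoc_zero]
    exact .tlam (.lam (.lam (.bvar 1)))
  have hr : CHasType (wrapImpl : CTm O) ((P.ctx (.wrap l)).right ρ nil) := by
    simp only [Policy.ctx, Policy.tlev, Ty.right, Ty.subst, h.right_lev, Ty.weaken, Ty.ren,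
      snoc_zero]
    exact .tlam (.lam (.lam (.bvar 1)))
  rw [← Tm.subst_closed wrapImpl Ty.fvar Ty.bvar Tm.fvar Tm.bvar] at hl hr ⊢
  refine valRel_tlam hl hr fun J hl hr => ValRel.evals ?_
  refine valRel_lam hl hr fun v w hvw hl hr => ValRel.evals ?_
  exact valRel_lam hl hr fun _ _ _ _ _ => hvw.evals

theorem valRel_convupImpl (h : EnvFor P ζ ρ) (l l' : L) (hll' : l < l') :
    ValRel ρ (P.ctx (.convup l l' hll')) nil convupImpl convupImpl := by
  have hl : CHasType (convupImpl : CTm O) ((P.ctx (.convup l l' hll')).left ρ nil) := by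
    simp only [Policy.ctx, Policy.tlev, Ty.left, Ty.subst, h.left_lev, Ty.weaken, Ty.ren,
      snoc_zero]
    exact .tlam (.lam (.bvar 0))
  have hr : CHasType (convupImpl : CTm O) ((P.ctx (.convup l l' hll')).right ρ nil) := by
    simp only [Policy.ctx, Policy.tlev, Ty.right, Ty.subst, h.right_lev, Ty.weaken, Ty.ren,
      snoc_zero]
    exact .tlam (.lam (.bvar 0))
  rw [← Tm.subst_closed convupImpl Ty.fvar Ty.bvar Tm.fvar Tm.bvar] at hl hr ⊢
  refine valRel_tlam hl hr fun J hl hr => ValRel.evals ?_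
  refine valRel_lam hl hr fun v w hvw _ _ => ValRel.evals ?_
  refine hvw.arr_mono ?_ ?_ fun v w hvw => ⟨?_, fun _ _ h => h⟩
  · simp only [Policy.tlev, Ty.left, Ty.subst, h.left_lev]
  · simp only [Policy.tlev, Ty.right, Ty.subst, h.right_lev]
  · have hv := hvw.isValueOf
    simp only [Policy.tlev, Ty.left, Ty.right, Ty.subst, h.left_lev, h.right_lev] at hv
    exact h.rel_lev (hll'.le.trans (h.le_of_rel_lev hvw)) hv.1 hv.2

theorem valRel_convImpl (h : EnvFor P ζ ρ) (x : I) (f : D) (l' : L)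
    (hF : P.F x = some (f, l')) :
    ValRel ρ (P.ctx (.conv x f l' hF)) nil convImpl convImpl := by
  have hl : CHasType (convImpl : CTm O) ((P.ctx (.conv x f l' hF)).left ρ nil) := by
    simp only [Policy.ctx, Policy.tlev, Policy.secretTy, Ty.left, Ty.subst, h.left_lev,
      h.left_key, h.left_val]
    exact .lam (.bvar 0)
  have hr : CHasType (convImpl : CTm O) ((P.ctx (.conv x f l' hF)).right ρ nil) := by
    simp only [Policy.ctx, Policy.tlev, Policy.secretTy, Ty.right, Ty.subst, h.right_lev,
      h.right_key, h.right_val]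
    exact .lam (.bvar 0)
  rw [← Tm.subst_closed convImpl Ty.fvar Ty.bvar Tm.fvar Tm.bvar] at hl hr ⊢
  refine valRel_lam hl hr fun v w hvw _ _ => ValRel.evals ?_
  refine ValRel.arr_mono hvw ?_ ?_ fun v w hvw => ?_
  · simp only [Policy.tlev, Ty.left, Ty.subst, h.left_lev, h.left_key, h.left_val]
  · simp only [Policy.tlev, Ty.right, Ty.subst, h.right_lev, h.right_key, h.right_val]
  · have hv := hvw.isValueOf
    simp only [Policy.tlev, Ty.left, Ty.right, Ty.subst, h.left_lev, h.right_lev] at hv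
    have hx : P.lvl x ≤ ζ := h.le_of_rel_lev hvw
    refine ⟨h.rel_key hF (.inl hx) hv.1 hv.2, fun v w hvw => ?_⟩
    simp only [ValRel, h.val_low x f l' hF hx] at hvw ⊢
    exact hvw

/-- Declassification is sound: at an observer above the target level, related inputs are
integers on which `f` behaves the same, or equal integers; for other observers the result type
is a function type with empty domain. -/
theorem valRel_decImpl (h : EnvFor P ζ ρ) (x : I) (f : D) (l' : L)
    (hF : P.F x = some (f, l')) :
    ValRel ρ (P.ctx (.decl x f l' hF)) nil (decImpl (P.dec f)) (decImpl (P.dec f)) := by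
  have typed : CHasType (decImpl (P.dec f))
      (.arr (.arr .unit .int) (.arr .unit (P.dec f).cod)) :=
    .lam (.lam (.app (CHasType.embed (P.dec f).typed _) (.app (.bvar 1) .star)))
  have hl : CHasType (decImpl (P.dec f)) ((P.ctx (.decl x f l' hF)).left ρ nil) := by
    simpa only [Policy.ctx, Policy.tlev, Policy.secretTy, Ty.left, Ty.subst, h.left_lev,
      h.left_key, h.left_val, Ty.embed_subst] using typed
  have hr : CHasType (decImpl (P.dec f)) ((P.ctx (.decl x f l' hF)).right ρ nil) := by
    simpa only [Policy.ctx, Policy.tlev, Policy.secretTy, Ty.right, Ty.subst, h.right_lev,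
      h.right_key, h.right_val, Ty.embed_subst] using typed
  rw [← Tm.subst_closed (decImpl (P.dec f)) Ty.fvar Ty.bvar Tm.fvar Tm.bvar] at hl hr ⊢
  refine valRel_lam hl hr fun v w hvw hl hr => ValRel.evals ?_
  refine valRel_lam hl hr fun _ _ hu _ _ => ?_
  have hl' : l' ≤ ζ := h.le_of_rel_lev hu
  simp only [Tm.subst, Tm.embed_subst, snoc_one, snoc_zero, valRel_embed]
  have hv := (hvw.2.2 .star .star
    (h.rel_key hF (.inr hl') isValueOf_unit_star isValueOf_unit_star)).2.2
  obtain ⟨u₁, u₂, -, -, s₁, s₂, hu⟩ := hv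
  -- `R_f` speaks of `f` applied to the values of the inputs, and `f` need not be a value itself.
  refine Evals.app_of_arg ?_ s₁ s₂
  by_cases hx : P.lvl x ≤ ζ
  · simp only [ValRel, h.val_low x f l' hF hx] at hu
    obtain ⟨k, rfl, rfl⟩ := hu
    exact CHasType.evals ((P.dec f).typed.app (.lit k))
  · simp only [ValRel, h.val_mid x f l' hF hl' hx] at hu
    exact hu.2.2.2.2

/-- If the observer does not see `l`, the composite must still evaluate, since `comp_l` runs
its arguments at once: this is where termination of typed terms is needed. -/
theorem valRel_compImpl (h : EnvFor P ζ ρ) (l : L) :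
    ValRel ρ (P.ctx (.comp l)) nil compImpl compImpl := by
  have hl : CHasType (compImpl : CTm O) ((P.ctx (.comp l)).left ρ nil) := by
    simp only [Policy.ctx, Policy.tlev, Ty.left, Ty.subst, h.left_lev, Ty.weaken, Ty.ren,
      snoc_zero, snoc_one]
    exact .tlam (.tlam (.lam (.lam (.app (.bvar 0) (.app (.bvar 1) .star)))))
  have hr : CHasType (compImpl : CTm O) ((P.ctx (.comp l)).right ρ nil) := by
    simp only [Policy.ctx, Policy.tlev, Ty.right, Ty.subst, h.right_lev, Ty.weaken, Ty.ren,
      snoc_zero, snoc_one]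
    exact .tlam (.tlam (.lam (.lam (.app (.bvar 0) (.app (.bvar 1) .star)))))
  rw [← Tm.subst_closed compImpl Ty.fvar Ty.bvar Tm.fvar Tm.bvar] at hl hr ⊢
  refine valRel_tlam hl hr fun J₁ hl hr => ValRel.evals ?_
  refine valRel_tlam hl hr fun J₂ hl hr => ValRel.evals ?_
  refine valRel_lam hl hr fun x₁ x₂ hx hl hr => ValRel.evals ?_
  refine valRel_lam hl hr fun g₁ g₂ hg hl hr => ?_
  simp only [Tm.subst, snoc_one, snoc_zero] at hl hr ⊢
  by_cases hζ : l ≤ ζ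
  · refine hg.evals.app (hx.evals.app ?_)
    exact ValRel.evals (h.rel_lev hζ isValueOf_unit_star isValueOf_unit_star)
  · obtain ⟨v₁, hv₁, s₁⟩ := hl.exists_value
    obtain ⟨v₂, hv₂, s₂⟩ := hr.exists_value
    exact ⟨v₁, v₂, hv₁.1, hv₂.1, s₁, s₂, hv₁, hv₂,
      fun _ _ hu => absurd (h.le_of_rel_lev hu) hζ⟩

end EnvFor

theorem FullEnv.valRel_ctx {ρ : Env P} (h : FullEnv P ζ ρ) (x : Var P) :
    ValRel ρ.ty (P.ctx x) nil (ρ.tm x).1 (ρ.tm x).2 := by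
  have ind : ∀ {t v w}, IndVal P ζ t v w → ValRel ρ.ty t nil v w := by
    rintro t v w ⟨ρ', h', hvw⟩
    rwa [h.env.unique h']
  cases x with
  | plain x hx => exact ind (h.plain x hx)
  | secret x f l hx => exact ind (h.secret x f l hx)
  | decl x f l hx => rw [h.decl]; exact h.env.valRel_decImpl x f l hx
  | conv x f l hx => rw [h.conv]; exact h.env.valRel_convImpl x f l hx
  | comp l => rw [h.comp]; exact h.env.valRel_compImpl l
  | convup l l' hl => rw [h.convup]; exact h.env.valRel_convupImpl l l' hl
  | wrap l => rw [h.wrap]; exact h.env.valRel_wrapImpl l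

end Interfaces

end MultiLevel

theorem mainTheorem4 (O : PrimOps) {L : Type*} [Lattice L] [Finite L] {I : Type*} [Finite I]
    {D : Type*} (P : Policy O L I D)
    (e : Tm O (TVar P) (Var P) 0 0) (τ : Ty (TVar P) 0) (he : HasType P.ctx nil e τ)
    (ζ : L) (ρ : Env P) (hρ : FullEnv P ζ ρ) :
    IndTerm P ζ τ (ρ.applyL e) (ρ.applyR e) := by
  have hθ : ∀ i : Fin 0, ValRel ρ.ty (nil i) nil (nil i) (nil i) := fun i => i.elim0
  have hl := he.left hρ.valRel_ctx hθ
  have hr := he.right hρ.valRel_ctx hθ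
  have hev := he.evals hρ.valRel_ctx hθ
  rw [Subsingleton.elim (fun i : Fin 0 => ((nil i : Interp O)).left) nil] at hl hev
  rw [Subsingleton.elim (fun i : Fin 0 => ((nil i : Interp O)).right) nil] at hr hev
  exact ⟨ρ.ty, hρ.env, hl, hr, hev⟩
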